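/- Let $q$ be a prime power. Let $\mathrm{PG}(2,q^3)$ have homogeneous coordinates $(x,y,z)$ over $\mathbb F_{q^3}$ and line at infinity $\ell_\infty: z=0$. Fixing an $\mathbb F_q$-basis of $\mathbb F_{q^3}$, let $\mathrm{PG}(6,q)$ be the projective space of the $7$-dimensional $\mathbb F_q$-space $\mathbb F_{q^3}\times\mathbb F_{q^3}\times\mathbb F_q$, with hyperplane $\Sigma_\infty: z=0$. In the Bruck–Bose representation an affine point $P=(\alpha,\beta,1)$ of $\mathrm{PG}(2,q^3)$ corresponds to the point $[P]=(\alpha,\beta,1)$ of $\mathrm{PG}(6,q)$, and a point $T=(\alpha,\beta,0)$ of $\ell_\infty$ to the plane $[T]=\{(\alpha x,\beta x,0):x\in\mathbb F_{q^3}\setminus\{0\}\}$ of $\Sigma_\infty$; for a set $X$ of points, $[X]$ denotes the corresponding set of points of $\mathrm{PG}(6,q)$. Let $\pi$ be an exterior order-$q$-subplane, i.e. an image of $\mathrm{PG}(2,q)$ under a homography of $\mathrm{PG}(2,q^3)$ that has no point on $\ell_\infty$. Its exterior splash $\mathbb S$ is the set of $q^2+q+1$ planes $[T]$, where $T$ runs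 over the points of $\ell_\infty$ on extended lines of $\pi$. A cover of $\mathbb S$ is a set of $q^2+q+1$ mutually disjoint planes of $\Sigma_\infty$ that together cover the same points as $\mathbb S$, each meeting each plane of $\mathbb S$ in exactly one point; there are exactly two covers. At a point $P$ of $\pi$, the tangent plane of $[\pi]$ is the plane spanned by the tangents at $P$ to the twisted cubics $[m\cap\pi]$, where $m$ runs over the lines of $\pi$ through $P$ and the tangents are taken with respect to the parametrisation of $m\cap\pi$ by $\mathrm{PG}(1,q)$. The tangent cover of $\pi$ is the cover such that, for every $P\in\pi$, the line in which the tangent plane at $P$ meets $\Sigma_\infty$ lies in one of its planes; the conic cover $\mathbb C$ of $\pi$ is the other cover. The group of homographies of $\mathrm{PG}(2,q^3)$ fixing $\pi$ and $\ell_\infty$ fixes exactly three points $E_1,E_2,E_3$. A $(\pi,\ell_\infty)$-special conic is a conic $\mathcal C$ of $\pi$ (the zero set in $\pi\cong\mathrm{PG}(2,q)$ of a nonzero ternary quadratic form over $\mathbb F_q$) whose extension to $\mathrm{PG}(2,q^3)$ contains $E_1,E_2,E_3$. **Theorem.** Let $\mathcal C$ be a $(\pi,\ell_\infty)$-special conic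 in an exterior order-$q$-subplane $\pi$ of $\mathrm{PG}(2,q^3)$, and let $\mathbb C$ be the conic cover of $\pi$. Then there is a $3$-space $W$ of $\mathrm{PG}(6,q)$ such that $[\mathcal C]$ is a twisted cubic of $W$ (the set of points $(s^3,s^2t,st^2,t^3)$, $(s,t)\in\mathbb F_q^2\setminus\{(0,0)\}$, in suitable homogeneous coordinates of $W$) and $W\cap\Sigma_\infty$ is a plane of $\mathbb C$. If $q\ge 3$, then $W$ is the only $3$-space of $\mathrm{PG}(6,q)$ containing $[\mathcal C]$. -/

import Mathlib

open scoped LinearAlgebra.Projectivization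

namespace BruckBose

/-! Throughout, `K` is the field of order `q` and `L` its cubic extension, of order `q ^ 3`.
The projective plane `PG(2, q³)` is `ℙ L (Fin 3 → L)`, with homogeneous coordinates `(x, y, z)`.
A homography of it is induced by an invertible linear map `A` of `Fin 3 → L`. -/

/-- The line at infinity `z = 0` of `PG(2, q³)`, as a subspace of the coordinate space. -/
def lineInf (L : Type*) [Field L] : Submodule L (Fin 3 → L) :=
  LinearMap.ker (LinearMap.proj 2)

/-- The points `(α, β, z)` of `PG(6, q)`: here `α` and `β` in `L` each stand for their three
coordinates over `K` with respect to a basis such as `1, τ, τ²`. -/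
abbrev Space6 (K L : Type*) : Type _ := L × L × K

/-- The hyperplane at infinity `z = 0` of `PG(6, q)`. -/
def sigmaInf (K L : Type*) [Field K] [Field L] [Algebra K L] : Submodule K (Space6 K L) :=
  LinearMap.ker ((LinearMap.snd K L K).comp (LinearMap.snd K L (L × K)))

/-- The `K`-linear map `(α, β, z) ↦ (α, β, z)` underlying the Bruck-Bose correspondence. -/
def incl (K L : Type*) [Field K] [Field L] [Algebra K L] :
    Space6 K L →ₗ[K] (Fin 3 → L) where
  toFun v := ![v.1, v.2.1, algebraMap K L v.2.2]
  map_add' v w := by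
    ext i; fin_cases i <;> simp
  map_smul' c v := by
    ext i; fin_cases i <;> simp [Algebra.smul_def]

section

variable (K : Type*) {L : Type*} [Field K] [Field L] [Algebra K L]

/-- The subspace `[P]` of `PG(6, q)` corresponding to a point `P` of `PG(2, q³)`. It is the point
`(α, β, 1)` if `P = (α, β, 1)` is affine, and the plane `{(α x, β x, 0) : x ∈ L}` of the regular
spread if `P = (α, β, 0)` is at infinity. -/
def bb (P : ℙ L (Fin 3 → L)) : Submodule K (Space6 K L) :=
  (P.submodule.restrictScalars K).comap (incl K L)

/-- The set `[X]` of points of `PG(6, q)` corresponding to a set `X` of points of `PG(2, q³)`. -/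
def bbSet (X : Set (ℙ L (Fin 3 → L))) : Set (ℙ K (Space6 K L)) :=
  {Q | ∃ P ∈ X, Q.submodule ≤ bb K P}

/-- The order-`q`-subplane of `PG(2, q³)` that is the image of `PG(2, q)` under the homography
`A`. -/
def subplane (A : (Fin 3 → L) ≃ₗ[L] (Fin 3 → L)) : Set (ℙ L (Fin 3 → L)) :=
  {P | ∃ w : Fin 3 → K, P.submodule = Submodule.span L {A (fun i => algebraMap K L (w i))}}

/-- The subplane is exterior: it has no point on the line at infinity. -/
def IsExterior (A : (Fin 3 → L) ≃ₗ[L] (Fin 3 → L)) : Prop :=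
  ∀ P ∈ subplane K A, ¬ P.submodule ≤ lineInf L

/-- The splash of the subplane: the points at infinity on an extended line of the subplane, that
is, on a line joining two distinct points of the subplane. -/
def splash (A : (Fin 3 → L) ≃ₗ[L] (Fin 3 → L)) : Set (ℙ L (Fin 3 → L)) :=
  {T | T.submodule ≤ lineInf L ∧ ∃ P ∈ subplane K A, ∃ Q ∈ subplane K A,
    P ≠ Q ∧ T.submodule ≤ P.submodule ⊔ Q.submodule}

/-- The planes of the regular spread corresponding to the points of the splash. -/
def splashPlanes (A : (Fin 3 → L) ≃ₗ[L] (Fin 3 → L)) : Set (Submodule K (Space6 K L)) :=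
  bb K '' splash K A

/-- `X` is a cover (switching set) of the splash: a set of `q² + q + 1` mutually disjoint planes
at infinity, covering the same points as the splash planes, each of them meeting each splash plane
in exactly one point. -/
structure IsCover (A : (Fin 3 → L) ≃ₗ[L] (Fin 3 → L))
    (X : Set (Submodule K (Space6 K L))) : Prop where
  card : X.ncard = Nat.card K ^ 2 + Nat.card K + 1
  plane : ∀ α ∈ X, α ≤ sigmaInf K L ∧ Module.finrank K α = 3
  disjoint : ∀ α ∈ X, ∀ β ∈ X, α ≠ β → α ⊓ β = ⊥
  covers : (⋃ α ∈ X, (α : Set (Space6 K L))) = ⋃ σ ∈ splashPlanes K A, (σ : Set (Space6 K L))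
  meets : ∀ α ∈ X, ∀ σ ∈ splashPlanes K A, Module.finrank K (α ⊓ σ : Submodule K (Space6 K L)) = 1

/-- The line in which the tangent plane of `[π]` at the point `P = A u` of the subplane `π` meets
infinity. For `w` in `K³` not proportional to `u`, the line of `π` joining `A u` and `A w`
corresponds to the curve `t ↦ (x / z, y / z, 1)` in `PG(6, q)`, where `(x, y, z) = A (u + t w)`
(clearing denominators by the norm of `z` makes it a twisted cubic). The listed vector is the
formal derivative at `t = 0`, so it is the point at infinity of the tangent to this curve at `P`;
the tangent plane is the plane spanned by these tangents. -/
def tangentTrace (A : (Fin 3 → L) ≃ₗ[L] (Fin 3 → L)) (u : Fin 3 → K) :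
    Submodule K (Space6 K L) :=
  Submodule.span K (Set.range fun w : Fin 3 → K =>
    let p := A (fun i => algebraMap K L (u i))
    let d := A (fun i => algebraMap K L (w i))
    (((d 0 * p 2 - p 0 * d 2) / p 2 ^ 2, (d 1 * p 2 - p 1 * d 2) / p 2 ^ 2, 0) : Space6 K L))

/-- The tangent cover of the subplane: the cover of its splash such that, for every point of the
subplane, the tangent plane there meets infinity in a line of some plane of the cover. -/
def IsTangentCover (A : (Fin 3 → L) ≃ₗ[L] (Fin 3 → L))
    (X : Set (Submodule K (Space6 K L))) : Prop :=
  IsCover K A X ∧ ∀ u : Fin 3 → K, u ≠ 0 → ∃ α ∈ X, tangentTrace K A u ≤ α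

/-- The conic cover of the subplane: the cover of its splash other than the tangent cover. -/
def IsConicCover (A : (Fin 3 → L) ≃ₗ[L] (Fin 3 → L))
    (X : Set (Submodule K (Space6 K L))) : Prop :=
  IsCover K A X ∧ ¬ IsTangentCover K A X

/-- The homographies fixing the subplane and the line at infinity. -/
def stab (A : (Fin 3 → L) ≃ₗ[L] (Fin 3 → L)) : Set ((Fin 3 → L) ≃ₗ[L] (Fin 3 → L)) :=
  {g | (fun P : ℙ L (Fin 3 → L) => g • P) '' subplane K A = subplane K A ∧
    (lineInf L).map (g : (Fin 3 → L) →ₗ[L] (Fin 3 → L)) = lineInf L}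

/-- The points of `PG(2, q³)` fixed by all homographies that fix the subplane and the line at
infinity. For an exterior subplane these are the three points `E₁, E₂, E₃`. -/
def fixedPoints (A : (Fin 3 → L) ≃ₗ[L] (Fin 3 → L)) : Set (ℙ L (Fin 3 → L)) :=
  {P | ∀ g ∈ stab K A, g • P = P}

variable {K} in
/-- The extension to `PG(2, q³)` of the conic of the subplane that has equation `F = 0` in the
coordinates which the subplane gets from `PG(2, q)` by `A`. -/
def conicExt (A : (Fin 3 → L) ≃ₗ[L] (Fin 3 → L)) (F : MvPolynomial (Fin 3) K) :
    Set (ℙ L (Fin 3 → L)) :=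
  {P | ∃ v : Fin 3 → L, P.submodule = Submodule.span L {A v} ∧ MvPolynomial.aeval v F = 0}

/-- `C` is (the point set of) a `(π, ℓ∞)`-special conic of the subplane `π`: a conic of `π` whose
extension to `PG(2, q³)` contains the fixed points `E₁, E₂, E₃`. -/
def IsSpecialConic (A : (Fin 3 → L) ≃ₗ[L] (Fin 3 → L)) (C : Set (ℙ L (Fin 3 → L))) : Prop :=
  ∃ F : MvPolynomial (Fin 3) K, F.IsHomogeneous 2 ∧ F ≠ 0 ∧
    fixedPoints K A ⊆ conicExt A F ∧ C = subplane K A ∩ conicExt A F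

end

/-- `N` is a twisted cubic of the 3-space `W`: for some basis `b` of `W` it consists of the points
with coordinates `(s³, s² t, s t², t³)`. (For `s = t = 0` no point arises.) -/
def IsTwistedCubic {K V : Type*} [Field K] [AddCommGroup V] [Module K V]
    (W : Submodule K V) (N : Set (ℙ K V)) : Prop :=
  ∃ b : Fin 4 → V, LinearIndependent K b ∧ Submodule.span K (Set.range b) = W ∧
    N = {P | ∃ s t : K, P.submodule =
      Submodule.span K {s ^ 3 • b 0 + (s ^ 2 * t) • b 1 + (s * t ^ 2) • b 2 + t ^ 3 • b 3}}

end BruckBose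

open BruckBose

/-! Write `s` for x ↦ x^q on `L`, N for the norm, and θ for the third coordinate on the subplane. As
the subplane is exterior, θ is a `K`-linear bijection from K³ onto `L`. The other two coordinates
are then combinations of θ, sθ, s²θ, and a linear change of coordinates of PG(6, q) preserving
infinity turns the subplane into the points (sθ, s²θ, θ). With ψ = 1/θ and denominators cleared by
the norm, these become (ψ² s²ψ, ψ² sψ, Nψ).

In this form the splash planes are y = -cx with N(c) = 1. A plane of a cover is a graph y = -g(x),
where each c of norm one is an eigenvalue of g with one-dimensional eigenspace and g(x)/x always has
norm one. Power sums over the nonzero elements of `L` force g = k s or g = k s² (`exists_eq_mul`),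
and disjointness forbids mixing the two kinds. Tangent planes meet infinity inside graphs of the s²
kind, so the conic cover contains all the graphs of the s kind.

The basis dual to the conjugate forms θ, sθ, s²θ represents points fixed by the stabiliser. A
quadratic form vanishing there has only mixed terms, so on the subplane it equals N(θ) T(1/θ) for a
`K`-valued functional T ≠ 0 (`exists_functional`). The conic is therefore given by ψ = xu + yv
running over the two-dimensional kernel of T, and substitution makes every coordinate a cubic in x,
y. The linear relation between (u, v) and its two conjugates identifies the plane at infinity of the
resulting 3-space (`exists_twistedCubic`). -/

namespace BruckBose

/-! ### The Frobenius automorphism of a cubic extension -/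

/-- The properties of the Frobenius automorphism `s` of a cubic extension `L` of the finite field
`K` on which the arguments rely. -/
structure IsCubicFrobenius {K L : Type*} [Field K] [Field L] [Algebra K L]
    (s : L ≃ₐ[K] L) : Prop where
  apply_eq : ∀ x, s x = x ^ Nat.card K
  cube : ∀ x, s (s (s x)) = x
  exists_of_fixed : ∀ x, s x = x → ∃ k : K, algebraMap K L k = x
  indep : ∀ a b c : L, (∀ x, a * x + b * s x + c * s (s x) = 0) → a = 0 ∧ b = 0 ∧ c = 0
  exists_coeffs : ∀ f : L →ₗ[K] L, ∃ a b c : L, ∀ x, f x = a * x + b * s x + c * s (s x)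

/-- Independence of 1, s, s² is Dedekind's theorem; since the `K`-endomorphisms of `L` have
dimension 3 over `L`, these three also span. -/
theorem exists_isCubicFrobenius (K L : Type*) [Field K] [Finite K] [Field L] [Algebra K L]
    (hL : Module.finrank K L = 3) : ∃ s : L ≃ₐ[K] L, IsCubicFrobenius s := by
  classical
  have : Module.Finite K L := Module.finite_of_finrank_pos (by omega)
  have := Fintype.ofFinite K
  have : Finite L := Module.finite_of_finite K
  let s := FiniteField.frobeniusAlgEquivOfAlgebraic K L
  have hs : ∀ x, s x = x ^ Nat.card K := fun x => by
    rw [Nat.card_eq_fintype_card]; rfl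
  have hord : orderOf s = 3 := by
    rw [← hL]; exact FiniteField.orderOf_frobeniusAlgEquivOfAlgebraic K L
  have hcube : ∀ x, s (s (s x)) = x := fun x => by
    have : s ^ 3 = 1 := by rw [← hord]; exact pow_orderOf_eq_one s
    simpa [pow_succ] using DFunLike.congr_fun this x
  have hinj : Function.Injective fun n : Fin 3 => (s ^ n.1 : L ≃ₐ[K] L) := by
    intro m n h
    have := pow_injOn_Iio_orderOf (x := s) (by simp [hord]) (by simp [hord]) h
    exact Fin.ext this
  have hli : LinearIndependent L fun n : Fin 3 =>
      ((s ^ n.1 : L ≃ₐ[K] L).toAlgHom.toLinearMap : L →ₗ[K] L) :=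
    (linearIndependent_algHom_toLinearMap K L L).comp
      (fun n : Fin 3 => (s ^ n.1 : L ≃ₐ[K] L).toAlgHom)
      (AlgEquiv.coe_toAlgHom_injective.comp hinj)
  have happ : ∀ (g : Fin 3 → L) (x : L),
      (∑ i, g i • ((s ^ i.1 : L ≃ₐ[K] L).toAlgHom.toLinearMap : L →ₗ[K] L)) x =
        g 0 * x + g 1 * s x + g 2 * s (s x) := by
    intro g x
    simp [Fin.sum_univ_three, pow_succ]
  refine ⟨s, hs, hcube, ?_, ?_, ?_⟩
  · intro x hx
    have := IsGalois.of_fixedField_eq_bot K L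
    have hall : ∀ g : L ≃ₐ[K] L, g x = x := by
      intro g
      obtain ⟨n, rfl⟩ := (FiniteField.bijective_frobeniusAlgEquivOfAlgebraic_pow K L).2 g
      change (s ^ n.1) x = x
      induction n.1 with
      | zero => rfl
      | succ m ih => rw [pow_succ, AlgEquiv.mul_apply, hx, ih]
    exact (IsGalois.mem_bot_iff_fixed x).2 hall
  · intro a b c h
    have := Fintype.linearIndependent_iff.1 hli ![a, b, c] (by
      ext x
      rw [happ]
      simpa using h x)
    exact ⟨this 0, this 1, this 2⟩
  · intro f
    have hfr : Module.finrank L (L →ₗ[K] L) = 3 := by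
      rw [Module.finrank_linearMap_self, hL]
    have hf : f ∈ (⊤ : Submodule L (L →ₗ[K] L)) := trivial
    have : Module.Finite L (L →ₗ[K] L) := Module.finite_of_finrank_pos (by omega)
    rw [← hli.span_eq_top_of_card_eq_finrank' (by simp [hfr]),
      Submodule.mem_span_range_iff_exists_fun] at hf
    obtain ⟨g, rfl⟩ := hf
    exact ⟨g 0, g 1, g 2, happ g⟩

/-- The norm of `L` over `K`, as a product of conjugates in `L`. -/
def conjNorm {K L : Type*} [Field K] [Field L] [Algebra K L] (s : L ≃ₐ[K] L) (x : L) : L :=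
  x * s x * s (s x)

namespace IsCubicFrobenius

variable {K L : Type*} [Field K] [Field L] [Algebra K L] {s : L ≃ₐ[K] L}

theorem conjNorm_ne_zero {x : L} (hx : x ≠ 0) : conjNorm s x ≠ 0 := by
  simp [conjNorm, hx]

theorem conjNorm_apply (hs : IsCubicFrobenius s) (x : L) : conjNorm s (s x) = conjNorm s x := by
  simp only [conjNorm, hs.cube]; ring

theorem conjNorm_mul (x y : L) : conjNorm s (x * y) = conjNorm s x * conjNorm s y := by
  simp only [conjNorm, map_mul]; ring

theorem conjNorm_div (x y : L) : conjNorm s (x / y) = conjNorm s x / conjNorm s y := by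
  simp only [conjNorm, map_div₀]
  simp only [div_eq_mul_inv, mul_inv]; ring

theorem exists_conjNorm (hs : IsCubicFrobenius s) (x : L) :
    ∃ k : K, algebraMap K L k = conjNorm s x := by
  apply hs.exists_of_fixed
  simp only [conjNorm, map_mul, hs.cube]; ring

/-- Hilbert's theorem 90. -/
theorem exists_div_eq (hs : IsCubicFrobenius s) {c : L} (hc : conjNorm s c = 1) :
    ∃ x, x ≠ 0 ∧ s x = c * x := by
  have hc0 : c ≠ 0 := by
    rintro rfl; simp [conjNorm] at hc
  -- The sum is a resolvent: applying `s` multiplies it by c, because N(c) = 1 closes the cycle.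
  have : ∃ y, y + c⁻¹ * s y + (c * s c)⁻¹ * s (s y) ≠ 0 := by
    by_contra! h
    exact one_ne_zero (hs.indep 1 c⁻¹ (c * s c)⁻¹ (by simpa using h)).1
  obtain ⟨y, hy⟩ := this
  refine ⟨_, hy, ?_⟩
  have h1 : s c ≠ 0 := by simpa
  have h2 : s (s c) ≠ 0 := by simpa
  simp only [map_add, map_mul, map_inv₀, hs.cube]
  have h3 : (s c * s (s c))⁻¹ = c := by
    refine inv_eq_of_mul_eq_one_left ?_
    rw [← hc, conjNorm]; ring
  rw [h3]
  field_simp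
  ring

/-- Two elements whose ratio is fixed by `s` are proportional over `K`. -/
theorem exists_smul_eq (hs : IsCubicFrobenius s) {x y : L} (hx : x ≠ 0)
    (h : y * s x = x * s y) : ∃ k : K, y = k • x := by
  have h1 : s x ≠ 0 := by simpa
  obtain ⟨k, hk⟩ := hs.exists_of_fixed (y / x) (by
    rw [map_div₀, div_eq_div_iff h1 hx]; linear_combination -h)
  exact ⟨k, by rw [Algebra.smul_def, hk]; field_simp⟩

end IsCubicFrobenius

variable {K L : Type*} [Field K] [Field L] [Algebra K L] {s : L ≃ₐ[K] L}

/-! ### Planes at infinity as graphs -/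

/-- The subspace `{(x, f x, 0) : x ∈ L}` of the hyperplane at infinity. -/
def graphInf (f : L →ₗ[K] L) : Submodule K (Space6 K L) :=
  LinearMap.range (LinearMap.id.prod (f.prod 0))

theorem mem_graphInf {f : L →ₗ[K] L} {v : Space6 K L} :
    v ∈ graphInf f ↔ v.2.1 = f v.1 ∧ v.2.2 = 0 := by
  obtain ⟨x, y, z⟩ := v
  simp only [graphInf, LinearMap.mem_range]
  constructor
  · rintro ⟨w, hw⟩
    simp only [LinearMap.prod_apply, Function.prod_apply, LinearMap.id_apply, Prod.mk.injEq,
      LinearMap.zero_apply] at hw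
    obtain ⟨rfl, h2, h3⟩ := hw
    exact ⟨h2.symm, h3.symm⟩
  · rintro ⟨h1, h2⟩
    exact ⟨x, by simp_all⟩

theorem finrank_graphInf (f : L →ₗ[K] L) :
    Module.finrank K (graphInf f) = Module.finrank K L := by
  refine LinearMap.finrank_range_of_inj fun x y h => ?_
  simpa using congrArg Prod.fst h

/-- The plane `{(x, -c x, 0) : x ∈ L}` of the regular spread. -/
def spreadPlane (K : Type*) {L : Type*} [Field K] [Field L] [Algebra K L] (c : L) :
    Submodule K (Space6 K L) :=
  graphInf (-(LinearMap.mulLeft K c))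

/-- The plane `{(x, -k x ^ q, 0) : x ∈ L}`. -/
def conicPlane (s : L ≃ₐ[K] L) (k : L) : Submodule K (Space6 K L) :=
  graphInf (-(LinearMap.mulLeft K k ∘ₗ s.toLinearMap))

/-- The plane `{(x, -k x ^ (q ^ 2), 0) : x ∈ L}`. -/
def tangentPlane (s : L ≃ₐ[K] L) (k : L) : Submodule K (Space6 K L) :=
  graphInf (-(LinearMap.mulLeft K k ∘ₗ s.toLinearMap ∘ₗ s.toLinearMap))

theorem mem_spreadPlane {c : L} {v : Space6 K L} :
    v ∈ spreadPlane K c ↔ v.2.1 = -(c * v.1) ∧ v.2.2 = 0 := by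
  simp [spreadPlane, mem_graphInf]

theorem mem_conicPlane {k : L} {v : Space6 K L} :
    v ∈ conicPlane s k ↔ v.2.1 = -(k * s v.1) ∧ v.2.2 = 0 := by
  simp [conicPlane, mem_graphInf]

theorem mem_tangentPlane {k : L} {v : Space6 K L} :
    v ∈ tangentPlane s k ↔ v.2.1 = -(k * s (s v.1)) ∧ v.2.2 = 0 := by
  simp [tangentPlane, mem_graphInf]

/-! ### Maps with equidistributed ratios, via power sums -/

namespace IsCubicFrobenius

/-- Hilbert 90 supplies one eigenvector, and two eigenvectors have a ratio fixed by `s`. -/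
theorem finrank_ker_sub (hs : IsCubicFrobenius s) {c : L} (hc : conjNorm s c = 1) :
    Module.finrank K (LinearMap.ker (s.toLinearMap - LinearMap.mulLeft K c)) = 1 := by
  obtain ⟨x, hx, hsx⟩ := hs.exists_div_eq hc
  refine finrank_eq_one_iff'.2 ⟨⟨x, by simp [hsx]⟩, by simpa using hx, ?_⟩
  rintro ⟨y, hy⟩
  have hy' : s y = c * y := by simpa [sub_eq_zero] using hy
  obtain ⟨k, hk⟩ := hs.exists_smul_eq hx (y := y) (by rw [hsx, hy']; ring)
  exact ⟨k, Subtype.ext hk.symm⟩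

variable [Fintype L] [DecidableEq L]

/-- The values `g x / x` of a map which has each element of norm one as an eigenvalue with
one-dimensional eigenspace are equidistributed over the elements of norm one. -/
theorem sum_ratio {g : L →ₗ[K] L} (hg : ∀ x, x ≠ 0 → conjNorm s (g x / x) = 1)
    (hker : ∀ c, conjNorm s c = 1 →
      Module.finrank K (LinearMap.ker (g - LinearMap.mulLeft K c)) = 1) (φ : L → L) :
    ∑ x ∈ Finset.univ.erase (0 : L), φ (g x / x) =
      -∑ c ∈ Finset.univ.filter (fun c => conjNorm s c = 1), φ c := by
  classical
  have : Finite K := Finite.of_injective _ (algebraMap K L).injective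
  rw [← Finset.sum_fiberwise_of_maps_to
    (t := Finset.univ.filter (fun c => conjNorm s c = 1)) (g := fun x => g x / x)
    (fun x hx => by simpa using hg x (by simpa using hx)), ← Finset.sum_neg_distrib]
  refine Finset.sum_congr rfl fun c hc => ?_
  have hc' : conjNorm s c = 1 := by simpa using hc
  rw [Finset.sum_congr rfl (g := fun _ => φ c) (fun x hx => by
    rw [(Finset.mem_filter.1 hx).2]), Finset.sum_const, nsmul_eq_mul]
  -- A fibre together with 0 is an eigenspace with q elements, so the fibre has q - 1 elements,
  -- which is -1 in `L`.
  have hset : insert 0 ((Finset.univ.erase (0 : L)).filter fun x => g x / x = c) =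
      Finset.univ.filter fun x => x ∈ LinearMap.ker (g - LinearMap.mulLeft K c) := by
    ext x
    by_cases hx : x = 0
    · simp [hx]
    · simp [hx, sub_eq_zero, div_eq_iff hx]
  have hcard := congrArg Finset.card hset
  rw [Finset.card_insert_of_notMem (by simp), ← Fintype.card_subtype, ← Nat.card_eq_fintype_card]
    at hcard
  have h2 : Nat.card (LinearMap.ker (g - LinearMap.mulLeft K c)) = Nat.card K := by
    rw [Module.natCard_eq_pow_finrank (K := K), hker c hc', pow_one]
  have h3 : ((Nat.card K : ℕ) : L) = 0 := by
    have := Fintype.ofFinite K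
    rw [Nat.card_eq_fintype_card, ← map_natCast (algebraMap K L), FiniteField.cast_card_eq_zero,
      map_zero]
  have h4 := congrArg (Nat.cast : ℕ → L) (hcard.trans h2)
  rw [h3] at h4
  push_cast at h4
  rw [eq_neg_of_add_eq_zero_left h4]; ring

theorem sum_pow_eq_zero {m : ℕ} (h0 : 0 < m) (h : m < Fintype.card L - 1) :
    ∑ x ∈ Finset.univ.erase (0 : L), x ^ m = 0 := by
  rw [Finset.sum_erase _ (by simp [h0.ne']), FiniteField.sum_pow_lt_card_sub_one L m h]

theorem sum_const (a : L) : ∑ _x ∈ Finset.univ.erase (0 : L), a = -a := by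
  rw [Finset.sum_const, Finset.card_erase_of_mem (Finset.mem_univ _), Finset.card_univ,
    nsmul_eq_mul, Nat.cast_sub Fintype.card_pos, FiniteField.cast_card_eq_zero]
  simp

/-- A linear map which has each element of norm one as an eigenvalue with one-dimensional
eigenspace is semilinear with respect to one of the two nontrivial automorphisms. -/
theorem exists_eq_mul (hs : IsCubicFrobenius s) (hL : Module.finrank K L = 3)
    {g : L →ₗ[K] L} (hg : ∀ x, x ≠ 0 → conjNorm s (g x / x) = 1)
    (hker : ∀ c, conjNorm s c = 1 →
      Module.finrank K (LinearMap.ker (g - LinearMap.mulLeft K c)) = 1) :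
    ∃ k, conjNorm s k = 1 ∧ ((∀ x, g x = k * s x) ∨ ∀ x, g x = k * s (s x)) := by
  have : Finite K := Finite.of_injective _ (algebraMap K L).injective
  set q := Nat.card K with hq
  have hq2 : 2 ≤ q := Finite.one_lt_card
  have hcard : Fintype.card L = q ^ 3 := by
    rw [← Nat.card_eq_fintype_card, Module.natCard_eq_pow_finrank (K := K), hL]
  have hsq : ∀ x, s x = x ^ q := hs.apply_eq
  have hsub : ∀ {x : L} (_ : x ≠ 0) {m n : ℕ} (_ : n ≤ m), x ^ m / x ^ n = x ^ (m - n) :=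
    fun hx _ _ h => (pow_sub₀ _ hx h).symm ▸ div_eq_mul_inv _ _
  have hq4 : 2 * q ≤ q ^ 2 := by nlinarith
  have hq3 : 2 * q ^ 2 ≤ q ^ 3 := by nlinarith [sq_nonneg q]
  have hsp : ∀ {m}, 0 < m → m < q ^ 3 - 1 → ∑ x ∈ Finset.univ.erase (0 : L), x ^ m = 0 :=
    fun h0 h => sum_pow_eq_zero h0 (by rwa [hcard])
  have hsne : ∀ {x : L}, x ≠ 0 → s x ≠ 0 := fun h => by simpa
  -- Since `s` itself satisfies both hypotheses, any sum over the ratios of g can be evaluated on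
  -- those of `s`.
  have key : ∀ φ : L → L, ∑ x ∈ Finset.univ.erase (0 : L), φ (g x / x) =
      ∑ x ∈ Finset.univ.erase (0 : L), φ (s x / x) := fun φ => by
    rw [sum_ratio hg hker φ]
    refine (sum_ratio (g := s.toLinearMap) (fun x hx => ?_) (fun c hc => hs.finrank_ker_sub hc)
      φ).symm
    rw [AlgEquiv.toLinearMap_apply, conjNorm_div, hs.conjNorm_apply,
      div_self (conjNorm_ne_zero hx)]
  have e1 : ∀ {x : L}, x ≠ 0 → s x / x = x ^ (q - 1) := fun {x} hx => by
    rw [← hsub hx (by omega), pow_one, hsq]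
  have e2 : ∀ {x : L}, x ≠ 0 → s (s x) / x = x ^ (q ^ 2 - 1) := fun {x} hx => by
    rw [← hsub hx (by nlinarith), pow_one, hsq, hsq, ← pow_mul, sq]
  obtain ⟨a, b, c, habc⟩ := hs.exists_coeffs g
  -- With φ the identity every nonconstant term is a power sum with exponent strictly between 0 and
  -- q³ - 1, hence zero; only the constant a survives.
  have ha : a = 0 := by
    have h1 := key id
    have h2 : ∀ x ∈ Finset.univ.erase (0 : L), id (g x / x) =
        a + b * x ^ (q - 1) + c * x ^ (q ^ 2 - 1) := fun x hx => by
      have hx : x ≠ 0 := by simpa using hx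
      rw [← e1 hx, ← e2 hx, id, habc]
      field_simp
    have h3 : ∀ x ∈ Finset.univ.erase (0 : L), id (s x / x) = x ^ (q - 1) :=
      fun x hx => e1 (by simpa using hx)
    rw [Finset.sum_congr rfl h2, Finset.sum_congr rfl h3,
      Finset.sum_add_distrib, Finset.sum_add_distrib, ← Finset.mul_sum, ← Finset.mul_sum,
      sum_const, hsp (by omega) (by omega), hsp (by omega) (by omega)] at h1
    simpa using h1
  -- With φ(y) = y^(q+1) the only constant term is b s(c); the other exponents are again strictly
  -- between 0 and q³ - 1.
  have hbc : b * s c = 0 := by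
    have h1 := key (fun y => y * s y)
    have h2 : ∀ x ∈ Finset.univ.erase (0 : L), g x / x * s (g x / x) =
        b * s c + b * s b * x ^ (q ^ 2 - 1) + c * s b * x ^ (2 * q ^ 2 - (q + 1)) +
          c * s c * x ^ (q ^ 2 - q) := fun x hx => by
      have hx : x ≠ 0 := by simpa using hx
      have hx' := hsne hx
      have e3 : x ^ (2 * q ^ 2 - (q + 1)) = s (s x) ^ 2 / (x * s x) := by
        rw [← hsub hx (by nlinarith), hsq, hsq, ← pow_mul, ← pow_mul]
        congr 2 <;> ring
      have e4 : x ^ (q ^ 2 - q) = s (s x) / s x := by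
        rw [← hsub hx (by omega), hsq, hsq, ← pow_mul, sq]
      rw [← e2 hx, e3, e4, habc, ha]
      simp only [map_div₀, map_add, map_mul, hs.cube, map_zero]
      field_simp
      ring
    have h3 : ∀ x ∈ Finset.univ.erase (0 : L), s x / x * s (s x / x) = x ^ (q ^ 2 - 1) :=
      fun x hx => by
        have hx : x ≠ 0 := by simpa using hx
        have hx' := hsne hx
        rw [← e2 hx, map_div₀]
        field_simp
    rw [Finset.sum_congr rfl h2, Finset.sum_congr rfl h3, Finset.sum_add_distrib,
      Finset.sum_add_distrib, Finset.sum_add_distrib, ← Finset.mul_sum, ← Finset.mul_sum,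
      ← Finset.mul_sum, ← Finset.mul_sum, sum_const, hsp (by omega) (by omega),
      hsp (by omega) (by omega), hsp (by omega) (by omega)] at h1
    simpa using h1
  have hg1 := hg 1 one_ne_zero
  rw [habc] at hg1
  rcases mul_eq_zero.1 hbc with hb | hc
  · refine ⟨c, by simpa [ha, hb] using hg1, Or.inr fun x => by rw [habc, ha, hb]; ring⟩
  · have hc : c = 0 := by simpa using hc
    refine ⟨b, by simpa [ha, hc] using hg1, Or.inl fun x => by rw [habc, ha, hc]; ring⟩

end IsCubicFrobenius

/-! ### Covers in normal form -/

/-- A cover of the set of planes `{(x, -c x, 0) : x ∈ L}` with `c` of norm one. -/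
structure IsNormalCover (s : L ≃ₐ[K] L) (X : Set (Submodule K (Space6 K L))) : Prop where
  plane : ∀ α ∈ X, Module.finrank K α = 3
  disjoint : ∀ α ∈ X, ∀ β ∈ X, α ≠ β → α ⊓ β = ⊥
  covers : ∀ v, (∃ α ∈ X, v ∈ α) ↔ ∃ c, conjNorm s c = 1 ∧ v ∈ spreadPlane K c
  meets : ∀ α ∈ X, ∀ c, conjNorm s c = 1 →
    Module.finrank K (α ⊓ spreadPlane K c : Submodule K (Space6 K L)) = 1

namespace IsNormalCover

variable {X : Set (Submodule K (Space6 K L))}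

/-- Each plane of a normal cover is the graph of a linear map. -/
theorem exists_graphInf (hX : IsNormalCover s X) (hL : Module.finrank K L = 3)
    {α : Submodule K (Space6 K L)} (hα : α ∈ X) : ∃ f : L →ₗ[K] L, α = graphInf f := by
  have : Module.Finite K L := Module.finite_of_finrank_pos (by omega)
  have hmem : ∀ v ∈ α, ∃ c, v.2.1 = -(c * v.1) ∧ v.2.2 = 0 := fun v hv => by
    obtain ⟨c, -, h⟩ := (hX.covers v).1 ⟨α, hα, hv⟩
    exact ⟨c, mem_spreadPlane.1 h⟩
  let p : α →ₗ[K] L := LinearMap.fst K L (L × K) ∘ₗ α.subtype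
  have hp : Function.Injective p := by
    rw [← LinearMap.ker_eq_bot, LinearMap.ker_eq_bot']
    rintro ⟨v, hv⟩ h
    obtain ⟨c, h1, h2⟩ := hmem v hv
    have h0 : v.1 = 0 := h
    exact Subtype.ext (Prod.ext h0 (Prod.ext (by simpa [h0] using h1) h2))
  let e : α ≃ₗ[K] L := LinearEquiv.ofInjectiveOfFinrankEq p hp (by rw [hX.plane α hα, hL])
  have he : ∀ x : L, ((e.symm x : α) : Space6 K L).1 = x := fun x => e.apply_symm_apply x
  let f : L →ₗ[K] L := LinearMap.fst K L K ∘ₗ LinearMap.snd K L (L × K) ∘ₗ α.subtype ∘ₗ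
    e.symm.toLinearMap
  refine ⟨f, ?_⟩
  symm
  refine Submodule.eq_of_le_of_finrank_eq (fun v hv => ?_) (by
    rw [finrank_graphInf, hX.plane α hα, hL])
  obtain ⟨h1, h2⟩ := mem_graphInf.1 hv
  have : v = (e.symm v.1 : α) := by
    refine Prod.ext (he _).symm (Prod.ext h1 ?_)
    obtain ⟨c, -, h⟩ := hmem _ (e.symm v.1).2
    rw [h2, h]
  rw [this]
  exact (e.symm v.1).2

/-- For the graph of f, `covers` says that -f(x)/x has norm one, and `meets` says that each
eigenspace of -f for an eigenvalue of norm one is a line over `K`. This is the input of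
`exists_eq_mul`. -/
theorem eq_conicPlane_or_eq_tangentPlane [Finite K] (hX : IsNormalCover s X)
    (hs : IsCubicFrobenius s) (hL : Module.finrank K L = 3)
    {α : Submodule K (Space6 K L)} (hα : α ∈ X) :
    ∃ k, conjNorm s k = 1 ∧ (α = conicPlane s k ∨ α = tangentPlane s k) := by
  classical
  have : Module.Finite K L := Module.finite_of_finrank_pos (by omega)
  have : Finite L := Module.finite_of_finite K
  have := Fintype.ofFinite L
  obtain ⟨f, rfl⟩ := hX.exists_graphInf hL hα
  obtain ⟨k, hk, h⟩ := hs.exists_eq_mul hL (g := -f) (fun x hx => by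
      obtain ⟨c, hc, h⟩ := (hX.covers (x, f x, 0)).1 ⟨_, hα, mem_graphInf.2 ⟨rfl, rfl⟩⟩
      have h1 := (mem_spreadPlane.1 h).1
      rw [← hc]
      congr 1
      rw [div_eq_iff hx]
      simp only at h1
      simp [h1]) (fun c hc => by
      rw [← hX.meets _ hα c hc]
      let j : L →ₗ[K] Space6 K L := LinearMap.id.prod (f.prod 0)
      have hj : Function.Injective j := fun x y h => by simpa [j] using congrArg Prod.fst h
      rw [(Submodule.equivMapOfInjective j hj
        (LinearMap.ker (-f - LinearMap.mulLeft K c))).finrank_eq]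
      suffices h : (LinearMap.ker (-f - LinearMap.mulLeft K c)).map j =
          graphInf f ⊓ spreadPlane K c by rw [h]
      ext v
      simp only [Submodule.mem_map, LinearMap.mem_ker, LinearMap.sub_apply, LinearMap.neg_apply,
        LinearMap.mulLeft_apply, Submodule.mem_inf, mem_graphInf, mem_spreadPlane]
      constructor
      · rintro ⟨x, hx, rfl⟩
        refine ⟨⟨rfl, rfl⟩, ?_, rfl⟩
        change f x = -(c * x)
        linear_combination -hx
      · rintro ⟨⟨h1, h2⟩, h3, -⟩
        refine ⟨v.1, by rw [← h1, h3]; ring, ?_⟩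
        exact Prod.ext rfl (Prod.ext h1.symm h2.symm))
  refine ⟨k, hk, h.imp (fun h => ?_) fun h => ?_⟩ <;>
  · ext v
    simp [mem_graphInf, mem_conicPlane, mem_tangentPlane, ← h]

/-- A cover consists either of all conic planes or of all tangent planes. -/
theorem forall_mem_or_forall_mem [Finite K] (hX : IsNormalCover s X) (hs : IsCubicFrobenius s)
    (hL : Module.finrank K L = 3) :
    (∀ k, conjNorm s k = 1 → conicPlane s k ∈ X) ∨
      ∀ k, conjNorm s k = 1 → tangentPlane s k ∈ X := by
  have key : ∀ k, conjNorm s k = 1 → ∃ α ∈ X, ((1, -k, 0) : Space6 K L) ∈ α := fun k hk =>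
    (hX.covers _).2 ⟨k, hk, mem_spreadPlane.2 (by simp)⟩
  by_cases h : ∃ k, conjNorm s k = 1 ∧ tangentPlane s k ∈ X
  · obtain ⟨k, hk, hkX⟩ := h
    right
    intro l hl
    obtain ⟨α, hα, hlα⟩ := key l hl
    obtain ⟨m, hm, rfl | rfl⟩ := hX.eq_conicPlane_or_eq_tangentPlane hs hL hα
    · by_cases heq : conicPlane s m = tangentPlane s k
      · rw [heq] at hlα
        have : l = k := by simpa [mem_tangentPlane] using hlα
        rwa [this]
      exfalso
      have hk0 : k ≠ 0 := by rintro rfl; simp [conjNorm] at hk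
      -- Planes of different kinds always share a point: at x = s²y the two conditions agree exactly
      -- when k sy = m y, which Hilbert 90 solves.
      obtain ⟨y, hy, hsy⟩ := hs.exists_div_eq (c := m / k) (by
        rw [IsCubicFrobenius.conjNorm_div, hk, hm, div_one])
      have hbot := hX.disjoint _ hα _ hkX heq
      have hmem : ((s (s y), -(m * y), 0) : Space6 K L) ∈
          conicPlane s m ⊓ tangentPlane s k := by
        refine ⟨mem_conicPlane.2 (by simp [hs.cube]), mem_tangentPlane.2 ⟨?_, rfl⟩⟩
        simp only [hs.cube]
        rw [hsy]
        field_simp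
      rw [hbot, Submodule.mem_bot, Prod.ext_iff] at hmem
      simp [hy] at hmem
    · have : l = m := by simpa [mem_tangentPlane] using hlα
      rwa [this]
  · left
    intro l hl
    obtain ⟨α, hα, hlα⟩ := key l hl
    obtain ⟨m, hm, rfl | rfl⟩ := hX.eq_conicPlane_or_eq_tangentPlane hs hL hα
    · have : l = m := by simpa [mem_conicPlane] using hlα
      rwa [this]
    · exact (h ⟨m, hm, hα⟩).elim

end IsNormalCover

/-! ### The twisted cubic of a two-dimensional parameter space -/

/-- The vector `v` is `(ψ² ψ^(q²), ψ² ψ^q, N(ψ))`, the affine point of the subplane in normal form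
whose parameter has inverse `ψ`. -/
def IsCubicPoint (s : L ≃ₐ[K] L) (ψ : L) (v : Space6 K L) : Prop :=
  v.1 = ψ ^ 2 * s (s ψ) ∧ v.2.1 = ψ ^ 2 * s ψ ∧ algebraMap K L v.2.2 = conjNorm s ψ

/-- The points whose parameters lie in a two-dimensional subspace form a twisted cubic in a
3-space which meets infinity in a conic plane. -/
theorem exists_twistedCubic (hs : IsCubicFrobenius s) (hL : Module.finrank K L = 3) {u v : L}
    (hD : u * s v - s u * v ≠ 0) :
    ∃ b : Fin 4 → Space6 K L, LinearIndependent K b ∧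
      (∀ x y : K, IsCubicPoint s (x • u + y • v)
        (x ^ 3 • b 0 + (x ^ 2 * y) • b 1 + (x * y ^ 2) • b 2 + y ^ 3 • b 3)) ∧
      ∃ k, conjNorm s k = 1 ∧ Submodule.span K (Set.range b) ⊓ sigmaInf K L = conicPlane s k := by
  have : Module.Finite K L := Module.finite_of_finrank_pos (by omega)
  obtain ⟨n0, hn0⟩ := hs.exists_conjNorm u
  obtain ⟨n3, hn3⟩ := hs.exists_conjNorm v
  obtain ⟨n1, hn1⟩ := hs.exists_of_fixed
    (u * s u * s (s v) + u * s v * s (s u) + v * s u * s (s u)) (by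
      simp only [map_add, map_mul, hs.cube]; ring)
  obtain ⟨n2, hn2⟩ := hs.exists_of_fixed
    (u * s v * s (s v) + v * s u * s (s v) + v * s v * s (s u)) (by
      simp only [map_add, map_mul, hs.cube]; ring)
  -- Put p = (u, v) and let f be the symmetric trilinear form on L² whose values on basis vectors
  -- are k₀, k₁, k₂, k₃. Then the coordinates of ∑ kᵢ bᵢ are f(p, p, s²p), f(p, p, sp) and f(p, sp,
  -- s²p). Working with f avoids dividing by 3.
  let b : Fin 4 → Space6 K L :=
    ![(u ^ 2 * s (s u), u ^ 2 * s u, n0),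
      (u ^ 2 * s (s v) + 2 * u * v * s (s u), u ^ 2 * s v + 2 * u * v * s u, n1),
      (v ^ 2 * s (s u) + 2 * u * v * s (s v), v ^ 2 * s u + 2 * u * v * s v, n2),
      (v ^ 2 * s (s v), v ^ 2 * s v, n3)]
  have hsum : ∀ k : Fin 4 → K, (∑ i, k i • b i).1 =
      algebraMap K L (k 0) * (u ^ 2 * s (s u)) +
      algebraMap K L (k 1) * (u ^ 2 * s (s v) + 2 * u * v * s (s u)) +
      algebraMap K L (k 2) * (v ^ 2 * s (s u) + 2 * u * v * s (s v)) +
      algebraMap K L (k 3) * (v ^ 2 * s (s v)) ∧ (∑ i, k i • b i).2.1 =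
      algebraMap K L (k 0) * (u ^ 2 * s u) +
      algebraMap K L (k 1) * (u ^ 2 * s v + 2 * u * v * s u) +
      algebraMap K L (k 2) * (v ^ 2 * s u + 2 * u * v * s v) +
      algebraMap K L (k 3) * (v ^ 2 * s v) ∧ (∑ i, k i • b i).2.2 =
      k 0 * n0 + k 1 * n1 + k 2 * n2 + k 3 * n3 := fun k => by
    simp only [Fin.sum_univ_four, b, Prod.fst_add, Prod.snd_add,
      Algebra.smul_def]
    exact ⟨rfl, rfl, rfl⟩
  have hker : ∀ k : Fin 4 → K, (∑ i, k i • b i).1 = 0 → (∑ i, k i • b i).2.1 = 0 → k = 0 := by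
    intro k h1 h2
    rw [(hsum k).1] at h1
    rw [(hsum k).2.1] at h2
    have h3 := congrArg s h1
    have h4 := congrArg s h2
    simp only [map_add, map_mul, map_pow, hs.cube, AlgEquiv.commutes, map_ofNat, map_zero]
      at h3 h4
    have hD' : s (s u) * v - u * s (s v) ≠ 0 := by
      have h5 : s (s (u * s v - s u * v)) ≠ 0 := by simpa only [ne_eq, map_eq_zero] using hD
      simpa only [map_sub, map_mul, hs.cube] using h5
    have hd' : s u * s (s v) - s (s u) * s v ≠ 0 := by
      have h5 : s (u * s v - s u * v) ≠ 0 := by simpa only [ne_eq, map_eq_zero] using hD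
      simpa only [map_sub, map_mul, hs.cube] using h5
    set k0 := algebraMap K L (k 0) with hk0
    set k1 := algebraMap K L (k 1) with hk1
    set k2 := algebraMap K L (k 2) with hk2
    set k3 := algebraMap K L (k 3) with hk3
    -- The three vectors satisfy [sp, s²p] p + [s²p, p] sp + [p, sp] s²p = 0, with brackets for
    -- determinants. Inserting this into f(p, p, ·) gives f(p, p, p) = 0, and into f(sp, sp, ·)
    -- gives f(sp, sp, sp) = 0 next.
    have e1 : k0 * u ^ 3 + 3 * k1 * u ^ 2 * v + 3 * k2 * u * v ^ 2 + k3 * v ^ 3 = 0 := by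
      refine (mul_eq_zero.1 ?_).resolve_left hd'
      linear_combination -(s (s u) * v - u * s (s v)) * h2 - (u * s v - s u * v) * h1
    have e2 : k0 * s u ^ 3 + 3 * k1 * s u ^ 2 * s v + 3 * k2 * s u * s v ^ 2 + k3 * s v ^ 3 = 0 := by
      refine (mul_eq_zero.1 ?_).resolve_left hD'
      linear_combination -(s u * s (s v) - s (s u) * s v) * h3 - (u * s v - s u * v) * h4
    -- Now f vanishes on all triples from p and sp, which form a basis of L² since [p, sp] ≠ 0;
    -- expanding the standard basis in them kills each kᵢ.
    have f0 : k0 = 0 := by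
      refine (mul_eq_zero.1 ?_).resolve_left (pow_ne_zero 3 hD)
      linear_combination s v ^ 3 * e1 - 3 * s v ^ 2 * v * h2 + 3 * s v * v ^ 2 * h3 - v ^ 3 * e2
    have f1 : k1 = 0 := by
      refine (mul_eq_zero.1 ?_).resolve_left (pow_ne_zero 3 hD)
      linear_combination -(s v ^ 2 * s u) * e1 + (s v ^ 2 * u + 2 * v * s v * s u) * h2 -
        (2 * v * s v * u + v ^ 2 * s u) * h3 + v ^ 2 * u * e2
    have f2 : k2 = 0 := by
      refine (mul_eq_zero.1 ?_).resolve_left (pow_ne_zero 3 hD)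
      linear_combination s v * s u ^ 2 * e1 - (2 * u * s u * s v + v * s u ^ 2) * h2 +
        (s v * u ^ 2 + 2 * u * s u * v) * h3 - v * u ^ 2 * e2
    have f3 : k3 = 0 := by
      refine (mul_eq_zero.1 ?_).resolve_left (pow_ne_zero 3 hD)
      linear_combination -s u ^ 3 * e1 + 3 * u * s u ^ 2 * h2 - 3 * u ^ 2 * s u * h3 + u ^ 3 * e2
    ext i
    fin_cases i
    · simpa [hk0] using f0
    · simpa [hk1] using f1
    · simpa [hk2] using f2
    · simpa [hk3] using f3
  have hb : LinearIndependent K b := Fintype.linearIndependent_iff.2 fun k hk i => by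
    rw [hker k (by rw [hk]; rfl) (by rw [hk]; rfl)]; rfl
  refine ⟨b, hb, fun x y => ?_, ?_⟩
  · have h := hsum ![x ^ 3, x ^ 2 * y, x * y ^ 2, y ^ 3]
    simp only [Fin.sum_univ_four, Matrix.cons_val] at h
    obtain ⟨h1, h2, h3⟩ := h
    refine ⟨?_, ?_, ?_⟩
    · rw [h1]
      simp only [Algebra.smul_def, map_add, map_mul, map_pow, AlgEquiv.commutes]
      ring
    · rw [h2]
      simp only [Algebra.smul_def, map_add, map_mul, map_pow, AlgEquiv.commutes]
      ring
    · rw [h3]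
      simp only [conjNorm] at hn0 hn3
      simp only [conjNorm, Algebra.smul_def, map_add, map_mul, map_pow, AlgEquiv.commutes, hn0,
        hn1, hn2, hn3]
      ring
  · have hd : s (s u) * v - u * s (s v) ≠ 0 := by
      have h5 : s (s (u * s v - s u * v)) ≠ 0 := by simpa only [ne_eq, map_eq_zero] using hD
      simpa only [map_sub, map_mul, hs.cube] using h5
    have hd' : s u * s (s v) - s (s u) * s v ≠ 0 := by
      have h5 : s (u * s v - s u * v) ≠ 0 := by simpa only [ne_eq, map_eq_zero] using hD
      simpa only [map_sub, map_mul, hs.cube] using h5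
    -- Here k = [s²p, p] / [sp, s²p]. The numerator is the image of the denominator under `s`, so
    -- N(k) = 1.
    refine ⟨(s (s u) * v - u * s (s v)) / (s u * s (s v) - s (s u) * s v), ?_, ?_⟩
    · rw [IsCubicFrobenius.conjNorm_div, div_eq_one_iff_eq (IsCubicFrobenius.conjNorm_ne_zero hd'),
        ← hs.conjNorm_apply (s u * s (s v) - s (s u) * s v)]
      simp only [map_sub, map_mul, hs.cube]
    · refine Submodule.eq_of_le_of_finrank_le (fun w hw => ?_) ?_
      · obtain ⟨hw1, hw2⟩ := hw
        obtain ⟨k, rfl⟩ := (Submodule.mem_span_range_iff_exists_fun K).1 hw1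
        have hz : (∑ i, k i • b i).2.2 = 0 := hw2
        refine mem_conicPlane.2 ⟨?_, hz⟩
        obtain ⟨h1, h2, h3⟩ := hsum k
        rw [hz] at h3
        have h4 := congrArg (algebraMap K L) h3
        simp only [map_add, map_mul, map_zero, hn0, hn1, hn2, hn3, conjNorm] at h4
        rw [h1, h2]
        simp only [map_add, map_mul, map_pow, hs.cube, AlgEquiv.commutes, map_ofNat]
        rw [div_mul_eq_mul_div, ← neg_div, eq_div_iff hd']
        -- The relation between p, sp and s²p, inserted into f(p, sp, ·).
        linear_combination (u * s v - s u * v) * h4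
      · rw [conicPlane, finrank_graphInf, hL]
        have h1 := Submodule.finrank_sup_add_finrank_inf_eq (Submodule.span K (Set.range b))
          (sigmaInf K L)
        rw [finrank_span_eq_card hb, Fintype.card_fin] at h1
        have h2 : Module.finrank K (sigmaInf K L) + 1 = 7 := by
          have := LinearMap.finrank_range_add_finrank_ker
            ((LinearMap.snd K L K).comp (LinearMap.snd K L (L × K)))
          rw [LinearMap.range_eq_top.2 (fun x => ⟨(0, 0, x), rfl⟩), finrank_top] at this
          simp only [Module.finrank_prod, Module.finrank_self, hL] at this
          rw [add_comm]
          exact this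
        have h3 := Submodule.finrank_le (Submodule.span K (Set.range b) ⊔ sigmaInf K L)
        simp only [Module.finrank_prod, Module.finrank_self, hL] at h3
        omega

/-! ### Coordinates of an exterior subplane -/

/-- The inclusion of `K³` in `L³`. -/
def emb (K L : Type*) [Field K] [Field L] [Algebra K L] : (Fin 3 → K) →ₗ[K] (Fin 3 → L) where
  toFun w := fun i => algebraMap K L (w i)
  map_add' v w := by ext i; simp
  map_smul' c v := by ext i; simp [Algebra.smul_def]

theorem emb_apply (w : Fin 3 → K) (i : Fin 3) : emb K L w i = algebraMap K L (w i) := rfl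

theorem emb_injective : Function.Injective (emb K L) := fun v w h => by
  ext i
  exact (algebraMap K L).injective (congrFun h i)

theorem emb_single (i : Fin 3) : emb K L (Pi.single i 1) = Pi.single i 1 := by
  ext j
  rw [emb_apply]
  by_cases h : j = i
  · subst h; simp
  · simp [h]

/-- An `L`-linear map on `L³` is determined by its values on `K³`. -/
theorem linearMap_ext_emb {V : Type*} [AddCommGroup V] [Module L V] {f g : (Fin 3 → L) →ₗ[L] V}
    (h : ∀ w : Fin 3 → K, f (emb K L w) = g (emb K L w)) : f = g := by
  refine LinearMap.pi_ext' fun i => LinearMap.ext_ring ?_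
  simpa [emb_single] using h (Pi.single i 1)

/-- Coordinates in which the points of an exterior subplane are parametrised by `L`. -/
structure Coords (s : L ≃ₐ[K] L) (A : (Fin 3 → L) ≃ₗ[L] (Fin 3 → L)) where
  /-- The parameter, that is, the third coordinate. -/
  θ : (Fin 3 → K) ≃ₗ[K] L
  /-- The coefficients of the first two coordinates, as functions of the parameter. -/
  (a b c a' b' c' : L)
  det_ne_zero : b * c' - c * b' ≠ 0
  apply_zero : ∀ w, A (emb K L w) 0 = a * θ w + b * s (θ w) + c * s (s (θ w))
  apply_one : ∀ w, A (emb K L w) 1 = a' * θ w + b' * s (θ w) + c' * s (s (θ w))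
  apply_two : ∀ w, A (emb K L w) 2 = θ w

theorem exists_coords (hs : IsCubicFrobenius s) (hL : Module.finrank K L = 3)
    (A : (Fin 3 → L) ≃ₗ[L] (Fin 3 → L)) (hA : IsExterior K A) : Nonempty (Coords s A) := by
  have : Module.Finite K L := Module.finite_of_finrank_pos (by omega)
  let X : Fin 3 → (Fin 3 → K) →ₗ[K] L := fun i =>
    (LinearMap.proj i : (Fin 3 → L) →ₗ[K] L) ∘ₗ (A.toLinearMap.restrictScalars K) ∘ₗ emb K L
  have hinj : Function.Injective (X 2) := by
    rw [← LinearMap.ker_eq_bot, LinearMap.ker_eq_bot']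
    intro w hw
    by_contra h
    have hne : A (emb K L w) ≠ 0 := by
      rw [ne_eq, map_eq_zero_iff _ A.injective, map_eq_zero_iff _ emb_injective]
      exact h
    refine hA (Projectivization.mk L _ hne) ⟨w, Projectivization.submodule_mk _ _⟩ ?_
    rw [Projectivization.submodule_mk, Submodule.span_singleton_le_iff_mem]
    exact hw
  let θ : (Fin 3 → K) ≃ₗ[K] L := LinearEquiv.ofInjectiveOfFinrankEq (X 2) hinj (by simp [hL])
  have hθ : ∀ w, θ w = A (emb K L w) 2 := fun w => rfl
  obtain ⟨a, b, c, h0⟩ := hs.exists_coeffs (X 0 ∘ₗ θ.symm.toLinearMap)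
  obtain ⟨a', b', c', h1⟩ := hs.exists_coeffs (X 1 ∘ₗ θ.symm.toLinearMap)
  have h0' : ∀ w, A (emb K L w) 0 = a * θ w + b * s (θ w) + c * s (s (θ w)) := fun w => by
    rw [← h0]
    change _ = A (emb K L (θ.symm (θ w))) 0
    rw [θ.symm_apply_apply]
  have h1' : ∀ w, A (emb K L w) 1 = a' * θ w + b' * s (θ w) + c' * s (s (θ w)) := fun w => by
    rw [← h1]
    change _ = A (emb K L (θ.symm (θ w))) 1
    rw [θ.symm_apply_apply]
  -- If both conjugate terms cancel, a linear form vanishes on all of A(L³) = L³, so its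
  -- coefficients are zero.
  have key : ∀ l m : L, l * b + m * b' = 0 → l * c + m * c' = 0 → l = 0 ∧ m = 0 := by
    intro l m hb hc
    let φ : (Fin 3 → L) →ₗ[L] L := l • LinearMap.proj 0 + m • LinearMap.proj 1 -
      (l * a + m * a') • LinearMap.proj 2
    have hφ : φ ∘ₗ A.toLinearMap = 0 := by
      refine linearMap_ext_emb (K := K) fun w => ?_
      change l * A (emb K L w) 0 + m * A (emb K L w) 1 - (l * a + m * a') * A (emb K L w) 2 = 0
      rw [h0', h1', ← hθ]
      linear_combination s (θ w) * hb + s (s (θ w)) * hc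
    have hφ' : ∀ x, φ x = 0 := fun x => by
      simpa using LinearMap.congr_fun hφ (A.symm x)
    exact ⟨by simpa [φ] using hφ' (Pi.single 0 1), by simpa [φ] using hφ' (Pi.single 1 1)⟩
  refine ⟨⟨θ, a, b, c, a', b', c', fun hdet => ?_, h0', h1', fun w => (hθ w).symm⟩⟩
  obtain ⟨rfl, hb⟩ := key b' (-b) (by ring) (by linear_combination -hdet)
  obtain rfl := neg_eq_zero.1 hb
  obtain ⟨rfl, hc⟩ := key c' (-c) (by ring) (by ring)
  obtain rfl := neg_eq_zero.1 hc
  exact one_ne_zero (key 1 0 (by ring) (by ring)).1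

namespace Coords

variable {A : (Fin 3 → L) ≃ₗ[L] (Fin 3 → L)} (H : Coords s A)

/-- The affine transformation of `PG(6, q)` carrying the normal form to the given subplane. -/
def equiv : Space6 K L ≃ₗ[K] Space6 K L where
  toFun v := (H.a * algebraMap K L v.2.2 + H.b * v.1 + H.c * v.2.1,
    H.a' * algebraMap K L v.2.2 + H.b' * v.1 + H.c' * v.2.1, v.2.2)
  map_add' v w := by
    refine Prod.ext ?_ (Prod.ext ?_ ?_) <;> simp <;> ring
  map_smul' k v := by
    refine Prod.ext ?_ (Prod.ext ?_ ?_) <;> simp [Algebra.smul_def] <;> ring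
  invFun v := ((H.c' * (v.1 - H.a * algebraMap K L v.2.2) -
      H.c * (v.2.1 - H.a' * algebraMap K L v.2.2)) / (H.b * H.c' - H.c * H.b'),
    (H.b * (v.2.1 - H.a' * algebraMap K L v.2.2) -
      H.b' * (v.1 - H.a * algebraMap K L v.2.2)) / (H.b * H.c' - H.c * H.b'), v.2.2)
  left_inv v := by
    have h := mul_inv_cancel₀ H.det_ne_zero
    refine Prod.ext ?_ (Prod.ext ?_ rfl)
    · simp only [div_eq_mul_inv]; linear_combination v.1 * h
    · simp only [div_eq_mul_inv]; linear_combination v.2.1 * h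
  right_inv v := by
    have h := mul_inv_cancel₀ H.det_ne_zero
    refine Prod.ext ?_ (Prod.ext ?_ rfl)
    · simp only [div_eq_mul_inv]
      linear_combination (v.1 - H.a * algebraMap K L v.2.2) * h
    · simp only [div_eq_mul_inv]
      linear_combination (v.2.1 - H.a' * algebraMap K L v.2.2) * h

theorem equiv_apply (v : Space6 K L) :
    H.equiv v = (H.a * algebraMap K L v.2.2 + H.b * v.1 + H.c * v.2.1,
      H.a' * algebraMap K L v.2.2 + H.b' * v.1 + H.c' * v.2.1, v.2.2) := rfl

theorem equiv_mem_map {α : Submodule K (Space6 K L)} {v : Space6 K L} :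
    H.equiv v ∈ α.map H.equiv.toLinearMap ↔ v ∈ α :=
  ⟨fun ⟨_, hw, h⟩ => H.equiv.injective h ▸ hw, fun h => ⟨v, h, rfl⟩⟩

theorem eq_zero_of_mul {x y : L} (h : H.b * x + H.c * y = 0) (h' : H.b' * x + H.c' * y = 0) :
    x = 0 ∧ y = 0 := by
  have := H.det_ne_zero
  refine ⟨(mul_eq_zero.1 ?_).resolve_left this, (mul_eq_zero.1 ?_).resolve_left this⟩
  · linear_combination H.c' * h - H.c * h'
  · linear_combination H.b * h' - H.b' * h

theorem map_sigmaInf : (sigmaInf K L).map H.equiv.toLinearMap = sigmaInf K L := by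
  ext v
  constructor
  · rintro ⟨w, hw, rfl⟩
    exact hw
  · intro hv
    exact ⟨H.equiv.symm v, hv, H.equiv.apply_symm_apply v⟩

theorem A_emb_ne_zero {w : Fin 3 → K} (hw : w ≠ 0) : A (emb K L w) ≠ 0 := by
  rwa [ne_eq, map_eq_zero_iff _ A.injective, map_eq_zero_iff _ emb_injective]

theorem conjNorm_div_self (hs : IsCubicFrobenius s) {x : L} (hx : x ≠ 0) :
    conjNorm s (s (s x) / x) = 1 := by
  rw [IsCubicFrobenius.conjNorm_div, hs.conjNorm_apply, hs.conjNorm_apply,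
    div_self (IsCubicFrobenius.conjNorm_ne_zero hx)]

section

variable (w₁ w₂ : Fin 3 → K)

/-- The Wronskian-like determinant of the parameters of two points of the subplane. -/
def delta : L := H.θ w₂ * s (H.θ w₁) - H.θ w₁ * s (H.θ w₂)

/-- The point at infinity of the line joining two points of the subplane. -/
def meetInf : Fin 3 → L := H.θ w₂ • A (emb K L w₁) - H.θ w₁ • A (emb K L w₂)

variable (hs : IsCubicFrobenius s)
include hs

/-- The terms in a and a' cancel, and since `s` has order three, θ₂ s²θ₁ - θ₁ s²θ₂ = -s²δ. -/
theorem meetInf_eq : H.meetInf w₁ w₂ =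
    ![H.b * H.delta w₁ w₂ - H.c * s (s (H.delta w₁ w₂)),
      H.b' * H.delta w₁ w₂ - H.c' * s (s (H.delta w₁ w₂)), 0] := by
  ext i
  fin_cases i
  · simp [meetInf, delta, H.apply_zero, hs.cube]; ring
  · simp [meetInf, delta, H.apply_one, hs.cube]; ring
  · simp [meetInf, H.apply_two]; ring

theorem bb_eq_of_submodule_eq (hδ : H.delta w₁ w₂ ≠ 0) {T : ℙ L (Fin 3 → L)}
    (hT : T.submodule = Submodule.span L {H.meetInf w₁ w₂}) :
    bb K T = (spreadPlane K (s (s (H.delta w₁ w₂)) / H.delta w₁ w₂)).map H.equiv.toLinearMap := by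
  ext v
  obtain ⟨u, rfl⟩ := H.equiv.surjective v
  rw [H.equiv_mem_map, mem_spreadPlane, bb, Submodule.mem_comap, Submodule.restrictScalars_mem, hT,
    Submodule.mem_span_singleton, H.meetInf_eq w₁ w₂ hs]
  constructor
  · rintro ⟨m, hm⟩
    have h0 := congrFun hm 0
    have h1 := congrFun hm 1
    have h2 := congrFun hm 2
    simp [incl, equiv_apply] at h0 h1 h2
    have h3 : u.2.2 = 0 := by simpa using h2.symm
    simp only [h3, map_zero, mul_zero, zero_add] at h0 h1
    obtain ⟨h4, h5⟩ := H.eq_zero_of_mul (x := m * H.delta w₁ w₂ - u.1)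
      (y := -m * s (s (H.delta w₁ w₂)) - u.2.1) (by linear_combination h0)
      (by linear_combination h1)
    refine ⟨?_, h3⟩
    rw [← sub_eq_zero.1 h4, ← sub_eq_zero.1 h5]
    field_simp
  · rintro ⟨h1, h2⟩
    refine ⟨u.1 / H.delta w₁ w₂, ?_⟩
    ext i
    fin_cases i
    · simp [incl, equiv_apply, h1, h2]; field_simp; ring
    · simp [incl, equiv_apply, h1, h2]; field_simp; ring
    · simp [incl, equiv_apply, h2]

theorem exists_bb_eq {T : ℙ L (Fin 3 → L)} (hT : T ∈ splash K A) :
    ∃ c, conjNorm s c = 1 ∧ bb K T = (spreadPlane K c).map H.equiv.toLinearMap := by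
  obtain ⟨hT0, P, ⟨w₁, hw₁⟩, Q, ⟨w₂, hw₂⟩, hPQ, hT1⟩ := hT
  change P.submodule = Submodule.span L {A (emb K L w₁)} at hw₁
  change Q.submodule = Submodule.span L {A (emb K L w₂)} at hw₂
  have hne : ∀ {R : ℙ L (Fin 3 → L)} {w : Fin 3 → K},
      R.submodule = Submodule.span L {A (emb K L w)} → H.θ w ≠ 0 := by
    intro R w h h0
    rw [LinearEquiv.map_eq_zero_iff] at h0
    have := R.finrank_submodule
    rw [h, h0, map_zero, map_zero, Submodule.span_zero_singleton, finrank_bot] at this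
    exact zero_ne_one this
  have h1 := hne hw₁
  have h2 := hne hw₂
  rw [hw₁, hw₂, Projectivization.submodule_eq, Submodule.span_singleton_le_iff_mem] at hT1
  rw [Projectivization.submodule_eq, Submodule.span_singleton_le_iff_mem] at hT0
  obtain ⟨x, hx, y, hy, hxy⟩ := Submodule.mem_sup.1 hT1
  obtain ⟨l, rfl⟩ := Submodule.mem_span_singleton.1 hx
  obtain ⟨m, rfl⟩ := Submodule.mem_span_singleton.1 hy
  have h3 : l * H.θ w₁ + m * H.θ w₂ = 0 := by
    rw [← H.apply_two, ← H.apply_two]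
    rw [← hxy] at hT0
    exact hT0
  have h4 : T.rep = (-(m / H.θ w₁)) • H.meetInf w₁ w₂ := by
    rw [← hxy, meetInf, smul_sub, smul_smul, smul_smul]
    have e1 : -(m / H.θ w₁) * H.θ w₂ = l := by field_simp; linear_combination -h3
    have e2 : -(m / H.θ w₁) * H.θ w₁ = -m := by field_simp
    rw [e1, e2, neg_smul, sub_neg_eq_add]
  have h5 : -(m / H.θ w₁) ≠ 0 := fun h => T.rep_nonzero (by rw [h4, h, zero_smul])
  have h6 : T.submodule = Submodule.span L {H.meetInf w₁ w₂} := by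
    rw [Projectivization.submodule_eq, h4, Submodule.span_singleton_smul_eq (Ne.isUnit h5)]
  -- If δ = 0, the ratio of the parameters is fixed by `s`, so it lies in `K` and the two points
  -- coincide.
  have hδ : H.delta w₁ w₂ ≠ 0 := by
    intro h
    obtain ⟨k, hk⟩ := hs.exists_smul_eq h1 (y := H.θ w₂) (sub_eq_zero.1 h)
    have hk0 : k ≠ 0 := by rintro rfl; simp [h2] at hk
    rw [← map_smul] at hk
    have hk := H.θ.injective hk
    apply hPQ
    apply Projectivization.submodule_injective
    rw [hw₁, hw₂, hk]
    have : A (emb K L (k • w₁)) = algebraMap K L k • A (emb K L w₁) := by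
      rw [map_smul, ← map_smul A]
      congr 1
      ext i
      simp [Algebra.smul_def]
    rw [this, Submodule.span_singleton_smul_eq (Ne.isUnit (by simpa))]
  exact ⟨_, conjNorm_div_self hs hδ, H.bb_eq_of_submodule_eq w₁ w₂ hs hδ h6⟩

theorem exists_mem_splash {c : L} (hc : conjNorm s c = 1) :
    ∃ T ∈ splash K A, bb K T = (spreadPlane K c).map H.equiv.toLinearMap := by
  have : ∃ τ, s τ - τ ≠ 0 := by
    by_contra! h
    exact one_ne_zero (hs.indep (-1) 1 0 (fun x => by linear_combination h x)).2.1
  obtain ⟨τ, hτ⟩ := this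
  have hτ' : s (s (s τ - τ)) ≠ 0 := by simpa only [ne_eq, map_eq_zero] using hτ
  obtain ⟨y, hy, hsy⟩ := hs.exists_div_eq (c := c / (s (s (s τ - τ)) / (s τ - τ))) (by
    rw [IsCubicFrobenius.conjNorm_div, hc, conjNorm_div_self hs hτ, div_one])
  have hy' : s (s y) ≠ 0 := by simpa
  -- With e = sτ - τ these parameters give δ = y s²y e, so s²δ/δ = (sy/y)(s²e/e); y was chosen to
  -- make this c.
  let w₁ := H.θ.symm (s (s y) * τ)
  let w₂ := H.θ.symm (s (s y))
  have hw₁ : H.θ w₁ = s (s y) * τ := H.θ.apply_symm_apply _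
  have hw₂ : H.θ w₂ = s (s y) := H.θ.apply_symm_apply _
  have hd : H.delta w₁ w₂ = s (s y) * y * (s τ - τ) := by
    rw [delta, hw₁, hw₂, map_mul, hs.cube]; ring
  have hδ : H.delta w₁ w₂ ≠ 0 := by
    rw [hd]; exact mul_ne_zero (mul_ne_zero hy' hy) hτ
  have hm : H.meetInf w₁ w₂ ≠ 0 := by
    rw [H.meetInf_eq w₁ w₂ hs]
    intro h
    have h0 := congrFun h 0
    have h1 := congrFun h 1
    simp at h0 h1
    exact hδ (H.eq_zero_of_mul (x := H.delta w₁ w₂) (y := -s (s (H.delta w₁ w₂)))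
      (by linear_combination h0) (by linear_combination h1)).1
  have hτ0 : τ ≠ 0 := by rintro rfl; simp at hτ
  have hw₁0 : w₁ ≠ 0 := by
    intro h; rw [h, map_zero] at hw₁; exact mul_ne_zero hy' hτ0 hw₁.symm
  have hw₂0 : w₂ ≠ 0 := by
    intro h; rw [h, map_zero] at hw₂; exact hy' hw₂.symm
  have hc' : s (s (H.delta w₁ w₂)) / H.delta w₁ w₂ = c := by
    have e : s (s (H.delta w₁ w₂)) = s y * s (s y) * s (s (s τ - τ)) := by
      rw [hd]; simp only [map_mul, hs.cube]
    have e' : s y * s (s (s τ - τ)) = c * (s τ - τ) * y := by rw [hsy]; field_simp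
    rw [div_eq_iff hδ, e, hd]
    linear_combination s (s y) * e'
  refine ⟨Projectivization.mk L _ hm, ⟨?_, Projectivization.mk L _ (A_emb_ne_zero hw₁0),
    ⟨w₁, Projectivization.submodule_mk _ _⟩, Projectivization.mk L _ (A_emb_ne_zero hw₂0),
    ⟨w₂, Projectivization.submodule_mk _ _⟩, ?_, ?_⟩, ?_⟩
  · rw [Projectivization.submodule_mk, Submodule.span_singleton_le_iff_mem,
      H.meetInf_eq w₁ w₂ hs]
    simp [lineInf]
  · intro h
    obtain ⟨l, hl⟩ := (Projectivization.mk_eq_mk_iff' _ _ _ _ _).1 h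
    have h2 := congrFun hl 2
    simp only [Pi.smul_apply, H.apply_two, smul_eq_mul] at h2
    exact hm (by rw [meetInf, ← h2, ← hl, smul_smul, mul_comm, sub_self])
  · simp only [Projectivization.submodule_mk]
    rw [Submodule.span_singleton_le_iff_mem, meetInf]
    exact Submodule.sub_mem _
      (Submodule.smul_mem _ _ (Submodule.mem_sup_left (Submodule.mem_span_singleton_self _)))
      (Submodule.smul_mem _ _ (Submodule.mem_sup_right (Submodule.mem_span_singleton_self _)))
  · rw [H.bb_eq_of_submodule_eq w₁ w₂ hs hδ (Projectivization.submodule_mk _ _), hc']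

/-- `exists_bb_eq` and `exists_mem_splash` together say that `H.equiv` carries the planes y = -cx
with N(c) = 1 exactly onto the splash planes. -/
theorem isNormalCover {X : Set (Submodule K (Space6 K L))} (hX : IsCover K A X) :
    IsNormalCover s {α | α.map H.equiv.toLinearMap ∈ X} where
  plane α hα := by
    rw [← (hX.plane _ hα).2, LinearEquiv.finrank_map_eq]
  disjoint α hα β hβ h := by
    have h1 := hX.disjoint _ hα _ hβ (fun h' => h (Submodule.map_injective_of_injective
      H.equiv.injective h'))
    rw [← Submodule.map_inf _ H.equiv.injective] at h1
    rw [← Submodule.map_bot H.equiv.toLinearMap] at h1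
    exact Submodule.map_injective_of_injective H.equiv.injective h1
  covers v := by
    have h := Set.ext_iff.1 hX.covers (H.equiv v)
    simp only [Set.mem_iUnion, SetLike.mem_coe, exists_prop] at h
    have h1 : (∃ α ∈ {α : Submodule K (Space6 K L) | α.map H.equiv.toLinearMap ∈ X}, v ∈ α) ↔
        ∃ α ∈ X, H.equiv v ∈ α := by
      constructor
      · rintro ⟨α, hα, hv⟩
        exact ⟨_, hα, H.equiv_mem_map.2 hv⟩
      · rintro ⟨α, hα, hv⟩
        have : (α.comap H.equiv.toLinearMap).map H.equiv.toLinearMap = α :=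
          Submodule.map_comap_eq_of_surjective H.equiv.surjective α
        exact ⟨α.comap H.equiv.toLinearMap, by rwa [Set.mem_ofPred_eq, this], hv⟩
    rw [h1, h]
    constructor
    · rintro ⟨-, ⟨T, hT, rfl⟩, hv⟩
      obtain ⟨c, hc, h2⟩ := H.exists_bb_eq hs hT
      exact ⟨c, hc, by rwa [h2, H.equiv_mem_map] at hv⟩
    · rintro ⟨c, hc, hv⟩
      obtain ⟨T, hT, h2⟩ := H.exists_mem_splash hs hc
      exact ⟨_, ⟨T, hT, rfl⟩, by rwa [h2, H.equiv_mem_map]⟩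
  meets α hα c hc := by
    obtain ⟨T, hT, h2⟩ := H.exists_mem_splash hs hc
    rw [← hX.meets _ hα _ ⟨T, hT, rfl⟩, h2, ← Submodule.map_inf _ H.equiv.injective,
      LinearEquiv.finrank_map_eq]

theorem tangentTrace_le {u : Fin 3 → K} (hu : u ≠ 0) :
    tangentTrace K A u ≤ (tangentPlane s ((s (s (H.θ u)) / H.θ u) ^ 2)).map
      H.equiv.toLinearMap := by
  rw [tangentTrace, Submodule.span_le]
  rintro _ ⟨w, rfl⟩
  have hθ : H.θ u ≠ 0 := by simpa using hu
  have hθ' : s (s (H.θ u)) ≠ 0 := by simpa using hu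
  have hemb : ∀ w : Fin 3 → K, (fun i => algebraMap K L (w i)) = emb K L w := fun _ => rfl
  -- The derivatives of sθ/θ and s²θ/θ at u in direction w.
  refine ⟨(-H.delta u w / H.θ u ^ 2, s (s (H.delta u w)) / H.θ u ^ 2, 0),
    mem_tangentPlane.2 ⟨?_, rfl⟩, ?_⟩
  · simp only [map_div₀, map_neg, map_pow, div_pow]
    field_simp
  · simp only [hemb, H.apply_zero, H.apply_one, H.apply_two]
    rw [LinearEquiv.coe_coe, equiv_apply]
    refine Prod.ext ?_ (Prod.ext ?_ rfl)
    · simp only [delta, map_sub, map_mul, hs.cube, map_zero]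
      field_simp
      ring
    · simp only [delta, map_sub, map_mul, hs.cube, map_zero]
      field_simp
      ring

/-- A cover containing all the graphs of the s² kind would be the tangent cover by
`tangentTrace_le`, which a conic cover is not. -/
theorem map_conicPlane_mem [Finite K] (hL : Module.finrank K L = 3)
    {X : Set (Submodule K (Space6 K L))}
    (hX : IsConicCover K A X) {k : L} (hk : conjNorm s k = 1) :
    (conicPlane s k).map H.equiv.toLinearMap ∈ X := by
  rcases (H.isNormalCover hs hX.1).forall_mem_or_forall_mem hs hL with h | h
  · exact h k hk
  · refine (hX.2 ⟨hX.1, fun u hu => ⟨_, h _ ?_, H.tangentTrace_le hs hu⟩⟩).elim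
    rw [sq, IsCubicFrobenius.conjNorm_mul, conjNorm_div_self hs (by simpa using hu), one_mul]

end

end Coords

/-! ### Fixed points of the stabiliser -/

theorem IsCubicFrobenius.eq_zero_of_sum (hs : IsCubicFrobenius s) {g : Fin 3 → L}
    (h : ∀ x, ∑ i, g i * (s ^ (i : ℕ)) x = 0) : g = 0 := by
  obtain ⟨h0, h1, h2⟩ := hs.indep (g 0) (g 1) (g 2) (fun x => by
    simpa [Fin.sum_univ_three, pow_succ] using h x)
  ext i
  fin_cases i <;> assumption

/-- A `K`-linear map from `K³` to `L` extends to an `L`-linear map on `L³`. -/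
theorem exists_extend (f : (Fin 3 → K) →ₗ[K] L) :
    ∃ g : (Fin 3 → L) →ₗ[L] L, ∀ w, g (emb K L w) = f w := by
  refine ⟨∑ i, (f (Pi.single i 1)) • LinearMap.proj i, fun w => ?_⟩
  rw [LinearMap.pi_apply_eq_sum_univ f w]
  simp [emb_apply, Algebra.smul_def, mul_comm]
  refine Finset.sum_congr rfl fun i _ => ?_
  congr 2
  ext j
  simp [Pi.single_apply, eq_comm]

/-- A homography of `L³` which maps the points of `K³` to points of `K³` is induced by a linear
map of `K³`. -/
theorem exists_descent (B : (Fin 3 → L) ≃ₗ[L] (Fin 3 → L))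
    (hB : ∀ w : Fin 3 → K, ∃ (l : L) (w' : Fin 3 → K), B (emb K L w) = l • emb K L w') :
    ∃ m : L, m ≠ 0 ∧ ∀ w : Fin 3 → K, ∃ w' : Fin 3 → K, B (emb K L w) = m • emb K L w' := by
  choose l f hf using fun i : Fin 3 => hB (Pi.single i 1)
  obtain ⟨m, f', hf'⟩ := hB (fun _ => 1)
  simp only [emb_single] at hf
  have hl : ∀ i, l i ≠ 0 := fun i h => by
    have h1 := hf i
    rw [h, zero_smul, map_eq_zero_iff _ B.injective] at h1
    simpa using congrFun h1 i
  have hsum : ∀ x : Fin 3 → L, B x = ∑ i, (x i * l i) • emb K L (f i) := fun x => by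
    conv_lhs => rw [← Finset.univ_sum_single x]
    rw [map_sum]
    refine Finset.sum_congr rfl fun i _ => ?_
    rw [mul_smul, ← hf, ← map_smul, ← Pi.single_smul', smul_eq_mul, mul_one]
  have hind : ∀ d : Fin 3 → L, ∑ i, d i • emb K L (f i) = 0 → d = 0 := fun d hd => by
    have h1 : B (fun i => d i / l i) = 0 := by
      rw [hsum, ← hd]
      exact Finset.sum_congr rfl fun i _ => by rw [div_mul_cancel₀ _ (hl i)]
    rw [map_eq_zero_iff _ B.injective] at h1
    ext i
    simpa [hl i] using congrFun h1 i
  have hemb : ∀ c : Fin 3 → K, emb K L (∑ i, c i • f i) =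
      ∑ i, algebraMap K L (c i) • emb K L (f i) := fun c => by
    rw [map_sum]
    exact Finset.sum_congr rfl fun i _ => by rw [map_smul, algebraMap_smul]
  have hli : LinearIndependent K f := Fintype.linearIndependent_iff.2 fun c hc i => by
    have h1 := congrFun (hind (fun i => algebraMap K L (c i)) (by rw [← hemb, hc, map_zero])) i
    simpa using h1
  have hmem : f' ∈ Submodule.span K (Set.range f) := by
    rw [hli.span_eq_top_of_card_eq_finrank' (by simp)]
    trivial
  obtain ⟨κ, hκ⟩ := (Submodule.mem_span_range_iff_exists_fun K).1 hmem
  -- The image of the unit point (1, 1, 1) ties the three scalars together: up to the common factor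
  -- m they lie in `K`.
  have hlm : ∀ i, l i = m * algebraMap K L (κ i) := fun i => by
    have h1 := congrFun (hind (fun i => l i - m * algebraMap K L (κ i)) (by
      have h2 := hsum (emb K L (fun _ => 1))
      rw [hf', ← hκ, hemb, Finset.smul_sum] at h2
      simp only [sub_smul, Finset.sum_sub_distrib, mul_smul]
      rw [h2, sub_eq_zero]
      exact Finset.sum_congr rfl fun i _ => by simp [emb_apply])) i
    exact sub_eq_zero.1 h1
  refine ⟨m, fun h => hl 0 (by rw [hlm, h, zero_mul]), fun w => ⟨∑ i, (w i * κ i) • f i, ?_⟩⟩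
  rw [hsum, hemb, Finset.smul_sum]
  refine Finset.sum_congr rfl fun i _ => ?_
  rw [smul_smul, hlm, emb_apply, map_mul]
  congr 1
  ring

namespace Coords

variable {A : (Fin 3 → L) ≃ₗ[L] (Fin 3 → L)} (H : Coords s A)

/-- The basis of `L³` dual to the conjugates of the form `H.θ`. -/
theorem exists_eigenbasis (hs : IsCubicFrobenius s) :
    ∃ (v : Fin 3 → Fin 3 → L) (ℓ : Fin 3 → (Fin 3 → L) →ₗ[L] L),
      (∀ i w, ℓ i (emb K L w) = (s ^ (i : ℕ)) (H.θ w)) ∧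
      (∀ i j, ℓ i (v j) = if i = j then 1 else 0) ∧ ∀ x, x = ∑ i, ℓ i x • v i := by
  choose p q r hpqr using fun i : Fin 3 =>
    hs.exists_coeffs ((LinearMap.proj i : (Fin 3 → L) →ₗ[K] L) ∘ₗ emb K L ∘ₗ H.θ.symm.toLinearMap)
  choose ℓ hℓ using fun i : Fin 3 =>
    exists_extend ((s ^ (i : ℕ) : L ≃ₐ[K] L).toLinearMap ∘ₗ H.θ.toLinearMap)
  have hℓ' : ∀ i w, ℓ i (emb K L w) = (s ^ (i : ℕ)) (H.θ w) := hℓ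
  have hx : ∀ x, x = ∑ i, ℓ i x • (![p, q, r] : Fin 3 → Fin 3 → L) i := by
    have : (LinearMap.id : (Fin 3 → L) →ₗ[L] (Fin 3 → L)) =
        ∑ i, (ℓ i).smulRight ((![p, q, r] : Fin 3 → Fin 3 → L) i) := by
      refine linearMap_ext_emb (K := K) fun w => ?_
      ext j
      have h := hpqr j (H.θ w)
      simp only [LinearMap.comp_apply, LinearEquiv.coe_coe, LinearEquiv.symm_apply_apply,
        LinearMap.proj_apply] at h
      simp only [LinearMap.id_apply, h, Fin.sum_univ_three]
      simp [hℓ', pow_succ]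
      ring
    intro x
    simpa using LinearMap.congr_fun this x
  refine ⟨![p, q, r], ℓ, hℓ', fun i j => ?_, hx⟩
  -- Applying ℓ i to the expansion of a vector of K³ gives an identity between conjugates of its
  -- parameter; independence of 1, s, s² lets coefficients be compared.
  have h := hs.eq_zero_of_sum (g := fun j => ℓ i ((![p, q, r] : Fin 3 → Fin 3 → L) j) -
      if i = j then 1 else 0) (fun x => by
    have h1 := hℓ' i (H.θ.symm x)
    rw [hx (emb K L (H.θ.symm x)), map_sum] at h1
    simp only [map_smul, hℓ', LinearEquiv.apply_symm_apply, smul_eq_mul] at h1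
    simp only [sub_mul, Finset.sum_sub_distrib, ite_mul, one_mul, zero_mul, Finset.sum_ite_eq,
      Finset.mem_univ, if_true]
    rw [← h1, sub_eq_zero]
    exact Finset.sum_congr rfl fun _ _ => mul_comm _ _)
  exact sub_eq_zero.1 (congrFun h j)

/-- A vector of the eigenbasis represents a fixed point of the stabiliser. -/
theorem mk_mem_fixedPoints {v : Fin 3 → Fin 3 → L} {ℓ : Fin 3 → (Fin 3 → L) →ₗ[L] L}
    (hℓ : ∀ i w, ℓ i (emb K L w) = (s ^ (i : ℕ)) (H.θ w))
    (hv : ∀ i j, ℓ i (v j) = if i = j then 1 else 0) (hx : ∀ x, x = ∑ i, ℓ i x • v i)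
    (j : Fin 3) (hj : A (v j) ≠ 0) : Projectivization.mk L (A (v j)) hj ∈ fixedPoints K A := by
  intro g hg
  obtain ⟨hg1, hg2⟩ := hg
  let B := (A.trans g).trans A.symm
  have hAB : ∀ x, A (B x) = g (A x) := fun x => A.apply_symm_apply _
  have hB : ∀ w : Fin 3 → K, ∃ (l : L) (w' : Fin 3 → K), B (emb K L w) = l • emb K L w' := by
    intro w
    by_cases hw : w = 0
    · exact ⟨0, 0, by simp [hw]⟩
    have hP : Projectivization.mk L _ (A_emb_ne_zero (A := A) hw) ∈ subplane K A :=
      ⟨w, Projectivization.submodule_mk _ _⟩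
    have hgP : g • Projectivization.mk L _ (A_emb_ne_zero (A := A) hw) ∈ subplane K A := by
      rw [← hg1]; exact ⟨_, hP, rfl⟩
    obtain ⟨w', hw'⟩ := hgP
    rw [Projectivization.smul_mk, Projectivization.submodule_mk] at hw'
    have h1 : g (A (emb K L w)) ∈ Submodule.span L {A (emb K L w')} := by
      change _ = Submodule.span L {A (emb K L w')} at hw'
      rw [← hw']
      exact Submodule.mem_span_singleton_self _
    obtain ⟨l, hl⟩ := Submodule.mem_span_singleton.1 h1
    refine ⟨l, w', A.injective ?_⟩
    rw [hAB, ← hl, map_smul]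
  obtain ⟨m, hm, hmB⟩ := exists_descent B hB
  have hA2 : ∀ x, A x 2 = ℓ 0 x := by
    have : (LinearMap.proj 2 : (Fin 3 → L) →ₗ[L] L) ∘ₗ A.toLinearMap = ℓ 0 :=
      linearMap_ext_emb (K := K) fun w => by rw [hℓ]; exact H.apply_two w
    exact LinearMap.congr_fun this
  -- Pulled back by A, the line at infinity is ℓ 0 = 0; as g preserves it, B only rescales ℓ 0.
  have hν : ∀ x, ℓ 0 (B x) = ℓ 0 (B (v 0)) * ℓ 0 x := by
    intro x
    have h1 : A (x - ℓ 0 x • v 0) ∈ lineInf L := by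
      change A (x - ℓ 0 x • v 0) 2 = 0
      rw [hA2, map_sub, map_smul, hv]; simp
    have h2 : g (A (x - ℓ 0 x • v 0)) ∈ lineInf L := by
      rw [← hg2]; exact ⟨_, h1, rfl⟩
    have h3 : g (A (x - ℓ 0 x • v 0)) 2 = 0 := h2
    rw [← hAB, hA2, map_sub, map_smul, map_sub, map_smul, smul_eq_mul] at h3
    linear_combination h3
  -- Up to the scalar m, B acts on K³ as multiplication of the parameter by ν. It therefore scales
  -- each conjugate form by m times the corresponding conjugate of ν, and the dual basis consists of
  -- eigenvectors.
  set ν := ℓ 0 (B (v 0)) / m with hνdef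
  have hBx : (B.toLinearMap : (Fin 3 → L) →ₗ[L] (Fin 3 → L)) =
      ∑ i : Fin 3, (ℓ i).smulRight ((m * (s ^ (i : ℕ)) ν) • v i) := by
    refine linearMap_ext_emb (K := K) fun w => ?_
    obtain ⟨w', hw'⟩ := hmB w
    have h1 : H.θ w' = ν * H.θ w := by
      have h2 := hν (emb K L w)
      rw [hw', map_smul, hℓ, hℓ] at h2
      simp only [Fin.val_zero, pow_zero, AlgEquiv.one_apply, smul_eq_mul] at h2
      rw [hνdef, div_mul_eq_mul_div, eq_div_iff hm, ← h2, mul_comm]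
    rw [LinearEquiv.coe_coe, hw', hx (emb K L w'), Finset.smul_sum, LinearMap.sum_apply]
    refine Finset.sum_congr rfl fun i _ => ?_
    rw [LinearMap.smulRight_apply, hℓ, hℓ, h1, map_mul, smul_smul, smul_smul]
    congr 1
    ring
  have hBv : B (v j) = (m * (s ^ (j : ℕ)) ν) • v j := by
    have h1 := LinearMap.congr_fun hBx (v j)
    simpa [LinearMap.sum_apply, hv] using h1
  rw [Projectivization.smul_mk, Projectivization.mk_eq_mk_iff']
  refine ⟨m * (s ^ (j : ℕ)) ν, ?_⟩
  rw [← map_smul, ← hBv, hAB]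
  rfl

end Coords

/-! ### Special conics and linear functionals -/

/-- A quadratic form is given by a matrix of coefficients. -/
theorem exists_coeffs_of_isHomogeneous_two {F : MvPolynomial (Fin 3) K} (hF : F.IsHomogeneous 2) :
    ∃ a : Fin 3 → Fin 3 → L, ∀ x : Fin 3 → L,
      MvPolynomial.aeval x F = ∑ i, ∑ j, a i j * (x i * x j) := by
  classical
  rw [MvPolynomial.as_sum F]
  refine Finset.sum_induction _ (fun p : MvPolynomial (Fin 3) K => ∃ a : Fin 3 → Fin 3 → L,
    ∀ x : Fin 3 → L, MvPolynomial.aeval x p = ∑ i, ∑ j, a i j * (x i * x j)) ?_ ?_ ?_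
  · rintro p p' ⟨a, ha⟩ ⟨a', ha'⟩
    refine ⟨fun i j => a i j + a' i j, fun x => ?_⟩
    simp only [map_add, ha, ha', add_mul, Finset.sum_add_distrib]
  · exact ⟨fun _ _ => 0, by simp⟩
  · intro d hd
    have hdeg : d.degree = 2 := by
      rw [Finsupp.degree_eq_weight_one]
      exact hF (MvPolynomial.mem_support_iff.1 hd)
    have hcard : Multiset.card (Finsupp.toMultiset d) = 2 := by
      rw [Finsupp.card_toMultiset, ← hdeg]
      rfl
    obtain ⟨i, j, hij⟩ := Multiset.card_eq_two.1 hcard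
    have hd' : d = Finsupp.single i 1 + Finsupp.single j 1 := by
      rw [← Finsupp.toMultiset_toFinsupp d, hij, Multiset.insert_eq_cons, ← Multiset.singleton_add,
        map_add, Multiset.toFinsupp_singleton, Multiset.toFinsupp_singleton]
    refine ⟨fun k l => if k = i then if l = j then algebraMap K L (F.coeff d) else 0 else 0,
      fun x => ?_⟩
    rw [MvPolynomial.aeval_monomial]
    simp only [ite_mul, zero_mul, Finset.sum_ite_irrel, Finset.sum_const_zero, Finset.sum_ite_eq',
      Finset.mem_univ, if_true]
    rw [hd', Finsupp.prod_add_index' (by simp) (by intros; rw [pow_add]),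
      Finsupp.prod_single_index (by simp), Finsupp.prod_single_index (by simp), pow_one, pow_one]

/-- A quadratic form which vanishes at three vectors has only mixed terms with respect to them. -/
theorem exists_mixed {F : MvPolynomial (Fin 3) K} (hF : F.IsHomogeneous 2)
    {v : Fin 3 → Fin 3 → L} (hv : ∀ i, MvPolynomial.aeval (v i) F = 0) :
    ∃ α β γ : L, ∀ t : Fin 3 → L, MvPolynomial.aeval (∑ i, t i • v i) F =
      α * (t 1 * t 2) + β * (t 0 * t 2) + γ * (t 0 * t 1) := by
  obtain ⟨a, ha⟩ := exists_coeffs_of_isHomogeneous_two (L := L) hF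
  refine ⟨∑ i, ∑ j, a i j * (v 1 i * v 2 j + v 2 i * v 1 j),
    ∑ i, ∑ j, a i j * (v 0 i * v 2 j + v 2 i * v 0 j),
    ∑ i, ∑ j, a i j * (v 0 i * v 1 j + v 1 i * v 0 j), fun t => ?_⟩
  have h : MvPolynomial.aeval (∑ i, t i • v i) F =
      ∑ i, ∑ j, a i j * (v 1 i * v 2 j + v 2 i * v 1 j) * (t 1 * t 2) +
      ∑ i, ∑ j, a i j * (v 0 i * v 2 j + v 2 i * v 0 j) * (t 0 * t 2) +
      ∑ i, ∑ j, a i j * (v 0 i * v 1 j + v 1 i * v 0 j) * (t 0 * t 1) +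
      t 0 ^ 2 * MvPolynomial.aeval (v 0) F + t 1 ^ 2 * MvPolynomial.aeval (v 1) F +
      t 2 ^ 2 * MvPolynomial.aeval (v 2) F := by
    simp only [ha, Finset.mul_sum, ← Finset.sum_add_distrib]
    refine Finset.sum_congr rfl fun i _ => Finset.sum_congr rfl fun j _ => ?_
    simp only [Finset.sum_apply, Pi.smul_apply, smul_eq_mul, Fin.sum_univ_three]
    ring
  rw [h, hv, hv, hv]
  simp only [Finset.sum_mul]
  ring

theorem aeval_smul_of_isHomogeneous_two {F : MvPolynomial (Fin 3) K} (hF : F.IsHomogeneous 2)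
    (t : L) (x : Fin 3 → L) :
    MvPolynomial.aeval (t • x) F = t ^ 2 * MvPolynomial.aeval x F := by
  obtain ⟨a, ha⟩ := exists_coeffs_of_isHomogeneous_two (L := L) hF
  simp only [ha, Finset.mul_sum, Pi.smul_apply, smul_eq_mul]
  exact Finset.sum_congr rfl fun i _ => Finset.sum_congr rfl fun j _ => by ring

theorem mem_conicExt_iff {A : (Fin 3 → L) ≃ₗ[L] (Fin 3 → L)} {F : MvPolynomial (Fin 3) K}
    (hF : F.IsHomogeneous 2) {P : ℙ L (Fin 3 → L)} {x : Fin 3 → L}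
    (hP : P.submodule = Submodule.span L {A x}) :
    P ∈ conicExt A F ↔ MvPolynomial.aeval x F = 0 := by
  constructor
  · rintro ⟨v, hv, h⟩
    have h1 : A x ∈ Submodule.span L {A v} := by
      rw [← hv, hP]; exact Submodule.mem_span_singleton_self _
    obtain ⟨t, ht⟩ := Submodule.mem_span_singleton.1 h1
    rw [← map_smul] at ht
    rw [← A.injective ht, aeval_smul_of_isHomogeneous_two hF, h, mul_zero]
  · exact fun h => ⟨x, hP, h⟩

namespace Coords

variable {A : (Fin 3 → L) ≃ₗ[L] (Fin 3 → L)} (H : Coords s A)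

/-- The inverses of the parameters of the points of a special conic are the nonzero elements of
the kernel of a nonzero `K`-linear functional. -/
theorem exists_functional [Finite K] (hs : IsCubicFrobenius s) {C : Set (ℙ L (Fin 3 → L))}
    (hC : IsSpecialConic K A C) :
    ∃ T : L →ₗ[K] L, T ≠ 0 ∧ (∀ x, ∃ k : K, algebraMap K L k = T x) ∧
      ∀ P : ℙ L (Fin 3 → L), P ∈ C ↔ ∃ w : Fin 3 → K, w ≠ 0 ∧
        P.submodule = Submodule.span L {A (emb K L w)} ∧ T (H.θ w)⁻¹ = 0 := by
  obtain ⟨F, hF, hF0, hfix, rfl⟩ := hC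
  obtain ⟨v, ℓ, hℓ, hv, hx⟩ := H.exists_eigenbasis hs
  have hvF : ∀ i, MvPolynomial.aeval (v i) F = 0 := fun i => by
    have hvi : A (v i) ≠ 0 := fun h => by
      rw [map_eq_zero_iff _ A.injective] at h
      have h1 := hv i i
      rw [h, map_zero, if_pos rfl] at h1
      exact zero_ne_one h1
    exact (mem_conicExt_iff hF (Projectivization.submodule_mk _ _)).1
      (hfix (H.mk_mem_fixedPoints hℓ hv hx i hvi))
  obtain ⟨α, β, γ, hmix⟩ := exists_mixed hF hvF
  let T : L →ₗ[K] L := LinearMap.mulLeft K α + LinearMap.mulLeft K β ∘ₗ s.toLinearMap +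
    LinearMap.mulLeft K γ ∘ₗ s.toLinearMap ∘ₗ s.toLinearMap
  have hT : ∀ x, T x = α * x + β * s x + γ * s (s x) := fun x => rfl
  -- Dividing the mixed terms by θ sθ s²θ = N(θ) leaves α/θ + β/sθ + γ/s²θ.
  have hFw : ∀ w : Fin 3 → K, w ≠ 0 →
      MvPolynomial.aeval (emb K L w) F = conjNorm s (H.θ w) * T (H.θ w)⁻¹ := by
    intro w hw
    have h0 : H.θ w ≠ 0 := by simpa using hw
    have h1 : s (H.θ w) ≠ 0 := by simpa using hw
    have h2 : s (s (H.θ w)) ≠ 0 := by simpa using hw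
    rw [hx (emb K L w), hmix, hT, conjNorm]
    simp only [hℓ, map_inv₀]
    simp [pow_succ]
    field_simp
  have hFK : ∀ w : Fin 3 → K, MvPolynomial.aeval (emb K L w) F =
      algebraMap K L (MvPolynomial.eval w F) := fun w => by
    have : emb K L w = algebraMap K L ∘ w := rfl
    rw [this, MvPolynomial.aeval_algebraMap_apply, MvPolynomial.aeval_eq_eval]
  refine ⟨T, ?_, ?_, ?_⟩
  · intro h
    apply hF0
    -- Homogeneity allows the degree to equal the order of the field, so q = 2 is included.
    refine hF.eq_zero_of_forall_eval_eq_zero_of_le_card (fun w => ?_) ?_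
    · apply (algebraMap K L).injective
      rw [← hFK, map_zero]
      by_cases hw : w = 0
      · rw [hw, map_zero, ← zero_smul L (0 : Fin 3 → L), aeval_smul_of_isHomogeneous_two hF]
        simp
      · rw [hFw w hw, h]; simp
    · have := Fintype.ofFinite K
      rw [Cardinal.mk_fintype]
      exact_mod_cast Fintype.one_lt_card (α := K)
  · intro x
    by_cases h : x = 0
    · exact ⟨0, by simp [h]⟩
    have hw : H.θ.symm x⁻¹ ≠ 0 := by simpa using h
    have h1 := hFw _ hw
    rw [hFK, LinearEquiv.apply_symm_apply, inv_inv] at h1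
    obtain ⟨n, hn⟩ := hs.exists_conjNorm x⁻¹
    refine ⟨n⁻¹ * MvPolynomial.eval (H.θ.symm x⁻¹) F, ?_⟩
    rw [map_mul, map_inv₀, hn, h1, inv_mul_cancel_left₀]
    exact IsCubicFrobenius.conjNorm_ne_zero (inv_ne_zero h)
  · intro P
    constructor
    · rintro ⟨⟨w, hw⟩, hP⟩
      change P.submodule = Submodule.span L {A (emb K L w)} at hw
      have hw0 : w ≠ 0 := by
        rintro rfl
        have := P.finrank_submodule
        rw [hw, map_zero, map_zero, Submodule.span_zero_singleton, finrank_bot] at this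
        exact zero_ne_one this
      rw [mem_conicExt_iff hF hw, hFw w hw0] at hP
      exact ⟨w, hw0, hw, (mul_eq_zero.1 hP).resolve_left
        (IsCubicFrobenius.conjNorm_ne_zero (by simpa using hw0))⟩
    · rintro ⟨w, hw0, hw, hP⟩
      refine ⟨⟨w, hw⟩, ?_⟩
      rw [mem_conicExt_iff hF hw, hFw w hw0, hP, mul_zero]

/-- The point of `PG(6, q)` corresponding to a point of the subplane. -/
theorem submodule_le_bb_iff {w : Fin 3 → K} (hw : w ≠ 0)
    {P : ℙ L (Fin 3 → L)} (hP : P.submodule = Submodule.span L {A (emb K L w)})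
    {v : Space6 K L} (hv : IsCubicPoint s (H.θ w)⁻¹ v) (Q : ℙ K (Space6 K L)) :
    Q.submodule ≤ bb K P ↔ Q.submodule = Submodule.span K {H.equiv v} := by
  obtain ⟨hv0, hv1, hv2⟩ := hv
  have h0 : H.θ w ≠ 0 := by simpa using hw
  have h1 : s (H.θ w) ≠ 0 := by simpa using hw
  have h2 : s (s (H.θ w)) ≠ 0 := by simpa using hw
  have hn : conjNorm s (H.θ w)⁻¹ ≠ 0 := IsCubicFrobenius.conjNorm_ne_zero (inv_ne_zero h0)
  have hv20 : v.2.2 ≠ 0 := fun h => by rw [h, map_zero] at hv2; exact hn hv2.symm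
  -- The factor N(ψ)ψ makes the third coordinate N(ψ), an element of `K`.
  have hincl : incl K L (H.equiv v) = (conjNorm s (H.θ w)⁻¹ * (H.θ w)⁻¹) • A (emb K L w) := by
    ext i
    fin_cases i
    · simp [incl, equiv_apply, H.apply_zero, hv0, hv1, hv2, conjNorm]
      field_simp
    · simp [incl, equiv_apply, H.apply_one, hv0, hv1, hv2, conjNorm]
      field_simp
    · simp [incl, equiv_apply, H.apply_two, hv2, conjNorm]
      field_simp
  have hinj : Function.Injective (incl K L) := fun x y h => by
    refine Prod.ext (congrFun h 0) (Prod.ext (congrFun h 1) ?_)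
    exact (algebraMap K L).injective (congrFun h 2)
  have hbb : bb K P = Submodule.span K {H.equiv v} := by
    apply le_antisymm
    · intro x hx
      rw [bb, Submodule.mem_comap, Submodule.restrictScalars_mem, hP] at hx
      obtain ⟨m, hm⟩ := Submodule.mem_span_singleton.1 hx
      have h3 : m * H.θ w = algebraMap K L x.2.2 := by
        rw [← H.apply_two]
        exact congrFun hm 2
      refine Submodule.mem_span_singleton.2 ⟨x.2.2 / v.2.2, hinj ?_⟩
      rw [map_smul, hincl, ← hm, ← algebraMap_smul L (x.2.2 / v.2.2), smul_smul, map_div₀, ← h3,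
        hv2]
      congr 1
      generalize conjNorm s (H.θ w)⁻¹ = n at hn
      field_simp
    · rw [Submodule.span_singleton_le_iff_mem, bb, Submodule.mem_comap,
        Submodule.restrictScalars_mem, hP, hincl]
      exact Submodule.smul_mem _ _ (Submodule.mem_span_singleton_self _)
  rw [hbb]
  refine ⟨fun h => ?_, fun h => h.le⟩
  refine Submodule.eq_of_le_of_finrank_eq h ?_
  rw [Q.finrank_submodule, finrank_span_singleton]
  intro h
  rw [map_eq_zero_iff _ H.equiv.injective] at h
  exact hv20 (by rw [h]; rfl)

end Coords

/-! ### The parameter space of the conic and the span of the cubic -/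

/-- The kernel of a nonzero functional on a cubic extension is spanned by two elements which are
not proportional. -/
theorem IsCubicFrobenius.exists_ker_eq (hs : IsCubicFrobenius s) (hL : Module.finrank K L = 3)
    {T : L →ₗ[K] L} (hT : T ≠ 0) (hTK : ∀ x, ∃ k : K, algebraMap K L k = T x) :
    ∃ u v : L, u * s v - s u * v ≠ 0 ∧ ∀ x, T x = 0 ↔ ∃ a b : K, x = a • u + b • v := by
  have : Module.Finite K L := Module.finite_of_finrank_pos (by omega)
  have hrange : Module.finrank K (LinearMap.range T) ≤ 1 := by
    have h1 : LinearMap.range T ≤ LinearMap.range (Algebra.linearMap K L) := by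
      rintro _ ⟨x, rfl⟩
      exact hTK x
    exact (Submodule.finrank_mono h1).trans ((LinearMap.finrank_range_le _).trans (by simp))
  have hrange' : Module.finrank K (LinearMap.range T) ≠ 0 := fun h => by
    rw [Submodule.finrank_eq_zero, LinearMap.range_eq_bot] at h
    exact hT h
  have hsum := LinearMap.finrank_range_add_finrank_ker T
  have hker : Module.finrank K (LinearMap.ker T) = 2 := by omega
  let b := Module.finBasisOfFinrankEq K (LinearMap.ker T) hker
  refine ⟨b 0, b 1, fun h => ?_, fun x => ⟨fun hx => ?_, ?_⟩⟩
  -- A vanishing determinant would make the basis vectors proportional over `K`.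
  · have hne : ((b 0 : LinearMap.ker T) : L) ≠ 0 := by simpa using b.ne_zero 0
    obtain ⟨k, hk⟩ := hs.exists_smul_eq (y := ((b 1 : LinearMap.ker T) : L)) hne
      (by linear_combination -h)
    have h1 := Fintype.linearIndependent_iff.1 b.linearIndependent ![k, -1] (by
      rw [Fin.sum_univ_two]
      apply Subtype.ext
      simp [hk]) 1
    simp at h1
  · have h1 := congrArg Subtype.val (b.sum_repr ⟨x, hx⟩)
    rw [Fin.sum_univ_two] at h1
    exact ⟨_, _, h1.symm⟩
  · rintro ⟨k, l, rfl⟩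
    rw [map_add, map_smul, map_smul, LinearMap.mem_ker.1 (b 0).2, LinearMap.mem_ker.1 (b 1).2]
    simp

/-- A subspace containing the points of a twisted cubic over a field with at least three elements
contains the 3-space of the cubic. -/
theorem span_le_of_forall_mem {K V : Type*} [Field K] [AddCommGroup V] [Module K V]
    {b : Fin 4 → V} {W : Submodule K V} {m : K} (hm0 : m ≠ 0) (hm1 : m ≠ 1)
    (h : ∀ x y : K,
      x ^ 3 • b 0 + (x ^ 2 * y) • b 1 + (x * y ^ 2) • b 2 + y ^ 3 • b 3 ∈ W) :
    Submodule.span K (Set.range b) ≤ W := by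
  have h0 : b 0 ∈ W := by simpa using h 1 0
  have h3 : b 3 ∈ W := by simpa using h 0 1
  have h12 : b 1 + b 2 ∈ W := by
    have h1 := W.sub_mem (W.sub_mem (h 1 1) h0) h3
    convert h1 using 1
    simp only [one_pow, mul_one, one_smul]
    abel
  have hm : m • b 1 + m ^ 2 • b 2 ∈ W := by
    have h1 := W.sub_mem (W.sub_mem (h 1 m) h0) (W.smul_mem (m ^ 3) h3)
    convert h1 using 1
    simp only [one_pow, one_mul, one_smul]
    abel
  have h2 : b 2 ∈ W := by
    have h1 := W.sub_mem hm (W.smul_mem m h12)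
    have h4 : m • b 1 + m ^ 2 • b 2 - m • (b 1 + b 2) = (m * (m - 1)) • b 2 := by module
    rw [h4] at h1
    exact (W.smul_mem_iff (mul_ne_zero hm0 (sub_ne_zero.2 hm1))).1 h1
  have h1 : b 1 ∈ W := by simpa using W.sub_mem h12 h2
  rw [Submodule.span_le]
  rintro _ ⟨i, rfl⟩
  fin_cases i <;> assumption

end BruckBose

/-! ### Assembly -/

theorem theorem3p2 {K L : Type*} [Field K] [Finite K] [Field L] [Algebra K L]
    (hL : Module.finrank K L = 3)
    (A : (Fin 3 → L) ≃ₗ[L] (Fin 3 → L)) (hA : IsExterior K A)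
    (CC : Set (Submodule K (Space6 K L))) (hCC : IsConicCover K A CC)
    (C : Set (ℙ L (Fin 3 → L))) (hC : IsSpecialConic K A C) :
    ∃ W : Submodule K (Space6 K L),
      IsTwistedCubic W (bbSet K C) ∧ W ⊓ sigmaInf K L ∈ CC ∧
      (3 ≤ Nat.card K → ∀ W' : Submodule K (Space6 K L), Module.finrank K W' = 4 →
        (∀ Q ∈ bbSet K C, Q.submodule ≤ W') → W' = W) := by
  have : Module.Finite K L := Module.finite_of_finrank_pos (by omega)
  obtain ⟨s, hs⟩ := exists_isCubicFrobenius K L hL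
  obtain ⟨H⟩ := exists_coords hs hL A hA
  obtain ⟨T, hT0, hTK, hT⟩ := H.exists_functional hs hC
  obtain ⟨u, v, hD, hker⟩ := hs.exists_ker_eq hL hT0 hTK
  obtain ⟨b, hb, hpt, k, hk, hbk⟩ := exists_twistedCubic hs hL hD
  let c : Fin 4 → Space6 K L := H.equiv ∘ b
  have hc : LinearIndependent K c := hb.map' H.equiv.toLinearMap H.equiv.ker
  have hspan : Submodule.span K (Set.range c) =
      (Submodule.span K (Set.range b)).map H.equiv.toLinearMap := by
    rw [Submodule.map_span, ← Set.range_comp]; rfl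
  have hcomb : ∀ x y : K,
      H.equiv (x ^ 3 • b 0 + (x ^ 2 * y) • b 1 + (x * y ^ 2) • b 2 + y ^ 3 • b 3) =
        x ^ 3 • c 0 + (x ^ 2 * y) • c 1 + (x * y ^ 2) • c 2 + y ^ 3 • c 3 := fun x y => by
    simp only [map_add, map_smul]; rfl
  have hparam : ∀ x y : K, x • u + y • v ≠ 0 → ∀ Q : ℙ K (Space6 K L), Q.submodule =
      Submodule.span K {x ^ 3 • c 0 + (x ^ 2 * y) • c 1 + (x * y ^ 2) • c 2 + y ^ 3 • c 3} →
      Q ∈ bbSet K C := by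
    intro x y hxy Q hQ
    have hw : H.θ.symm (x • u + y • v)⁻¹ ≠ 0 := by simpa using hxy
    have hP := Projectivization.submodule_mk (K := L) _ (Coords.A_emb_ne_zero (A := A) hw)
    refine ⟨Projectivization.mk L _ (Coords.A_emb_ne_zero (A := A) hw), (hT _).2 ⟨_, hw, hP, ?_⟩,
      (H.submodule_le_bb_iff hw hP (by simpa using hpt x y) Q).2 (by rw [hQ, hcomb])⟩
    rw [LinearEquiv.apply_symm_apply, inv_inv, hker]
    exact ⟨x, y, rfl⟩
  have hbb : bbSet K C = {P | ∃ x y : K, P.submodule = Submodule.span K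
      {x ^ 3 • c 0 + (x ^ 2 * y) • c 1 + (x * y ^ 2) • c 2 + y ^ 3 • c 3}} := by
    ext Q
    constructor
    · rintro ⟨P, hP, hQ⟩
      obtain ⟨w, hw, hPw, hTw⟩ := (hT P).1 hP
      obtain ⟨x, y, hxy⟩ := (hker _).1 hTw
      exact ⟨x, y, by
        rw [(H.submodule_le_bb_iff hw hPw (hxy ▸ hpt x y) Q).1 hQ, hcomb]⟩
    · rintro ⟨x, y, hQ⟩
      -- A zero parameter gives the zero vector, which spans no projective point.
      refine hparam x y (fun h => ?_) Q hQ
      obtain ⟨h1, h2, h3⟩ := hpt x y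
      rw [h] at h1 h2 h3
      have h0 : x ^ 3 • b 0 + (x ^ 2 * y) • b 1 + (x * y ^ 2) • b 2 + y ^ 3 • b 3 = 0 := by
        refine Prod.ext (by rw [h1]; simp) (Prod.ext (by rw [h2]; simp) ?_)
        apply (algebraMap K L).injective
        rw [h3]
        simp [conjNorm]
      have hfin := Q.finrank_submodule
      rw [hQ, ← hcomb, h0, map_zero, Submodule.span_zero_singleton, finrank_bot] at hfin
      exact zero_ne_one hfin
  refine ⟨Submodule.span K (Set.range c), ⟨c, hc, rfl, hbb⟩, ?_, ?_⟩
  · rw [hspan, ← H.map_sigmaInf, ← Submodule.map_inf _ H.equiv.injective, hbk]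
    exact H.map_conicPlane_mem hs hL hCC hk
  · classical
    intro hq W' hW' hQ
    have := Fintype.ofFinite K
    -- For q ≥ 3 the points (1, 0), (0, 1), (1, 1) and (1, m) of the cubic already span W; for q = 2
    -- there are only three points.
    obtain ⟨m, hm⟩ : ∃ m : K, m ∉ ({0, 1} : Finset K) := by
      by_contra! h
      have h1 : Fintype.card K ≤ 2 :=
        (Finset.card_le_card (fun x _ => h x)).trans Finset.card_le_two
      rw [Nat.card_eq_fintype_card] at hq
      omega
    simp only [Finset.mem_insert, Finset.mem_singleton, not_or] at hm
    symm
    refine Submodule.eq_of_le_of_finrank_eq (span_le_of_forall_mem hm.1 hm.2 fun x y => ?_) (by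
      rw [finrank_span_eq_card hc, hW']; rfl)
    by_cases h0 : x ^ 3 • c 0 + (x ^ 2 * y) • c 1 + (x * y ^ 2) • c 2 + y ^ 3 • c 3 = 0
    · rw [h0]; exact W'.zero_mem
    · have h1 := hQ (Projectivization.mk K _ h0) (by
        rw [hbb]; exact ⟨x, y, Projectivization.submodule_mk _ _⟩)
      rwa [Projectivization.submodule_mk, Submodule.span_singleton_le_iff_mem] at h1
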